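/- Let $U\subseteq\mathbb{R}^3$ be open. A smooth map $\varphi:U\to S^3=SU(2)$ (Euclidean metric on $U$, round metric on the unit sphere $S^3\subset\mathbb{R}^4$) is *restricted harmonic* if its Dirichlet energy $E_2(\varphi)=\frac12\int_U|\mathrm{d}\varphi|^2$ is finite and $\frac{d}{dt}\big|_{t=0}E_2(\varphi\circ\psi_t)=0$ for every smooth curve $\psi_t$, $\psi_0=\mathrm{id}$, of volume preserving diffeomorphisms of $U$ with compact support (contained in a compact subset of $U$ independent of $t$). A *profile function* with $k\in\mathbb{Z}$ is a smooth $f:[0,\infty)\to\mathbb{R}$ with $f(0)=k\pi$ and $\lim_{r\to\infty}f(r)=0$. For a map $\mathscr{R}:S^2\to S^2$, the suspension of $\mathscr{R}$ by $f$ is $$\varphi_{f,\mathscr{R}}:\mathbb{R}^3\to S^3,\qquad \varphi_{f,\mathscr{R}}(rn)=(\cos f(r),\ \sin f(r)\,\mathscr{R}(n)),\qquad r\ge 0,\ n\in S^2;$$ the hedgehog is $\varphi_f=\varphi_{f,\mathrm{id}}$, and the rational map ansatz consists of the suspensions $\varphi_{f,\mathscr{R}}$ with $\mathscr{R}$ holomorphic.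 Such fields need not be smooth at the origin. The degree of $\varphi$ is $\frac{1}{2\pi^2}\int_{\mathbb{R}^3}\varphi^*\mathrm{vol}_{S^3}$, with $S^3$ oriented by $\mathrm{vol}_{S^3}(u,v,w)=\det(u,v,w,q)$ for $u,v,w\in T_qS^3$. 1. Let $f$ be a profile function with $f(0)=k\pi$ whose hedgehog has finite Dirichlet energy. Then $\varphi_f$ is continuous on $\mathbb{R}^3$, tends to $(1,0,0,0)$ at infinity, has degree $k$ (the integral converging absolutely), and is restricted harmonic on $\mathbb{R}^3\setminus\{0\}$. If $\varphi_f$ is smooth on $\mathbb{R}^3$, then it is restricted harmonic on $\mathbb{R}^3$. 2. For every $k\in\mathbb{Z}$ there is a profile function $f$ with $f(0)=k\pi$, non-increasing if $k\ge0$ and non-decreasing if $k\le 0$, such that $\varphi_f$ is restricted harmonic on $\mathbb{R}^3$, is continuous, tends to $(1,0,0,0)$ at infinity, and has degree $k$. 3. Let $f$ be a profile function and $\mathscr{R}:S^2\to S^2$ a non-constant holomorphic map. If $\varphi_{f,\mathscr{R}}$ is restricted harmonic on $\mathbb{R}^3\setminus\{0\}$, then it is a hedgehog up to a rotation: there is $A\in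 SO(3)$ with $\varphi_{f,\mathscr{R}}(x)=\varphi_f(Ax)$ for all $x\in\mathbb{R}^3$. If moreover $f$ is not identically zero, then $\mathscr{R}(n)=An$ for all $n\in S^2$. -/

import Mathlib

open MeasureTheory Filter Topology Set
open scoped ContDiff Manifold

noncomputable section

namespace Skyrme

/-- Physical space `ℝ³` with its Euclidean metric. -/
abbrev E3 : Type := EuclideanSpace ℝ (Fin 3)

/-- The Euclidean space `ℝ⁴` that contains the target `S³`. -/
abbrev E4 : Type := EuclideanSpace ℝ (Fin 4)

/-- The unit two-sphere. -/
abbrev S2 : Type := Metric.sphere (0 : E3) 1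

/-- The unit three-sphere, i.e. `SU(2)`, where `(a, b) ∈ ℝ × ℝ³` stands for `a 𝕀₂ + i b · τ`. -/
abbrev S3 : Type := Metric.sphere (0 : E4) 1

/-- The `i`-th coordinate vector of `ℝ³`. -/
def basisVec (i : Fin 3) : E3 := EuclideanSpace.single i 1

/-- The vector product on `ℝ³`. -/
def cross (v w : E3) : E3 := WithLp.toLp 2 (crossProduct v.ofLp w.ofLp)

/-! ### Restricted harmonic maps from an open subset of `ℝ³` to `S³` -/

/-- The `i`-th partial derivative of `φ`, as a vector of the ambient `ℝ⁴`. -/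
def partialD (φ : E3 → S3) (i : Fin 3) (x : E3) : E4 :=
  fderiv ℝ (fun y => (φ y : E4)) x (basisVec i)

/-- `|dφ|²` with respect to the Euclidean metric on `ℝ³` and the round metric on `S³`. -/
def energyDensity (φ : E3 → S3) (x : E3) : ℝ := ∑ i, ‖partialD φ i x‖ ^ 2

/-- `φ` has finite Dirichlet energy on `U`. -/
def FiniteEnergy (U : Set E3) (φ : E3 → S3) : Prop :=
  IntegrableOn (energyDensity φ) U

/-- The Dirichlet energy `E₂(φ) = ½ ∫_U |dφ|²`. -/
def dirichletEnergy (U : Set E3) (φ : E3 → S3) : ℝ :=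
  (1 / 2) * ∫ x in U, energyDensity φ x

/-- `φ` is smooth on `U`, as a map into the submanifold `S³` of `ℝ⁴`. -/
def SmoothOn (U : Set E3) (φ : E3 → S3) : Prop :=
  ContDiffOn ℝ ∞ (fun x => (φ x : E4)) U

/-- `ψ` is a smooth curve through the identity in the group of volume preserving diffeomorphisms
of the open set `U` with compact support. A diffeomorphism of `U` with compact support is the same
thing as a diffeomorphism of `ℝ³` that is the identity outside a compact subset of `U`. As usual
for smooth curves of compactly supported diffeomorphisms, the support stays in one compact set. -/
structure IsSDiffCurve (U : Set E3) (ψ : ℝ → (E3 ≃ₘ[ℝ] E3)) : Prop where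
  smooth : ContDiff ℝ ∞ (fun p : ℝ × E3 => ψ p.1 p.2)
  zero : ∀ x, ψ 0 x = x
  support : ∃ K : Set E3, IsCompact K ∧ K ⊆ U ∧ ∀ t, ∀ x ∉ K, ψ t x = x
  volume_preserving : ∀ t x, (fderiv ℝ (ψ t) x).det = 1

/-- `φ : U → S³` is restricted harmonic: it is smooth, has finite Dirichlet energy, and is a
critical point of the Dirichlet energy for all variations `φ ∘ ψ_t`, where `ψ_t` is a smooth curve
through the identity in the group of compactly supported volume preserving diffeomorphisms
of `U`. -/
structure RestrictedHarmonic (U : Set E3) (φ : E3 → S3) : Prop where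
  smooth : SmoothOn U φ
  finite : FiniteEnergy U φ
  critical : ∀ ψ : ℝ → (E3 ≃ₘ[ℝ] E3), IsSDiffCurve U ψ →
    HasDerivAt (fun t : ℝ => dirichletEnergy U (φ ∘ ψ t)) 0 0

/-! ### Skyrme fields and their degree -/

/-- The point `(1, 0, 0, 0)` of `S³`, i.e. the identity matrix of `SU(2)`. -/
def vacuum : S3 := ⟨EuclideanSpace.single 0 1, by simp⟩

/-- A (continuous) Skyrme field: `φ → 𝕀₂` at spatial infinity. -/
structure IsSkyrmeField (φ : E3 → S3) : Prop where
  continuous : Continuous φ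
  boundary : Tendsto φ (cocompact E3) (𝓝 vacuum)

/-- The function `b` with `φ^* vol_{S³} = b dx₁ ∧ dx₂ ∧ dx₃`, where `S³` is oriented by
`vol_{S³}(u, v, w) = det (u, v, w, q)` for `u, v, w` tangent at `q`. -/
def degreeDensity (φ : E3 → S3) (x : E3) : ℝ :=
  Matrix.det ![(partialD φ 0 x).ofLp, (partialD φ 1 x).ofLp, (partialD φ 2 x).ofLp,
    (φ x : E4).ofLp]

/-- `φ` has degree `B`: `φ^* vol_{S³}` is integrable with integral `B · vol(S³) = 2π² B`. -/
def HasDegree (φ : E3 → S3) (B : ℤ) : Prop :=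
  Integrable (degreeDensity φ) ∧ ∫ x, degreeDensity φ x = 2 * Real.pi ^ 2 * B

/-! ### Suspensions and hedgehogs -/

/-- The direction `x / |x| ∈ S²` of a vector `x ≠ 0` (an arbitrary point of `S²` if `x = 0`). -/
def direction (x : E3) : S2 :=
  if hx : x = 0 then ⟨basisVec 2, by simp [basisVec]⟩
  else ⟨‖x‖⁻¹ • x, by simp [norm_smul, hx]⟩

/-- The point `(cos α, sin α n)` of `S³`. -/
def polarPoint (α : ℝ) (n : S2) : S3 :=
  ⟨!₂[Real.cos α, Real.sin α * (n : E3) 0, Real.sin α * (n : E3) 1, Real.sin α * (n : E3) 2], by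
    have hn : (n : E3) 0 ^ 2 + (n : E3) 1 ^ 2 + (n : E3) 2 ^ 2 = 1 := by
      have h := n.2
      rw [mem_sphere_zero_iff_norm] at h
      have h2 := EuclideanSpace.real_norm_sq_eq (n : E3)
      rw [h, Fin.sum_univ_three] at h2
      linarith
    rw [mem_sphere_zero_iff_norm, EuclideanSpace.norm_eq, Real.sqrt_eq_one]
    simp only [Real.norm_eq_abs, sq_abs, Fin.sum_univ_four]
    simp
    linear_combination (Real.sin α) ^ 2 * hn + Real.sin_sq_add_cos_sq α⟩

/-- A smooth profile function `f : [0, ∞) → ℝ` with `f(0) = kπ` and `f(∞) = 0`. -/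
structure IsProfile (k : ℤ) (f : ℝ → ℝ) : Prop where
  smooth : ContDiffOn ℝ ∞ f (Ici 0)
  zero : f 0 = k * Real.pi
  infty : Tendsto f atTop (𝓝 0)

/-- The suspension of `R : S² → S²` by `f`: the map `r n ↦ (cos f(r), sin f(r) R(n))`. -/
def suspension (f : ℝ → ℝ) (R : S2 → S2) (x : E3) : S3 :=
  polarPoint (f ‖x‖) (R (direction x))

/-- The hedgehog field `r n ↦ (cos f(r), sin f(r) n)`. -/
def hedgehog (f : ℝ → ℝ) : E3 → S3 := suspension f id

/-- The extension of `R : S² → S²` to `ℝ³ ∖ {0}` that is constant on rays, as a map into `ℝ³`. -/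
def rayExtension (R : S2 → S2) (x : E3) : E3 := R (direction x)

/-- `R : S² → S²` is holomorphic for the complex structure `J_n v = n × v`, `v ⊥ n`, of the round
sphere (the Riemann sphere, in stereographic coordinates): `R` is smooth and `dR ∘ J = J ∘ dR`.
Smoothness and the differential of `R` are expressed by the extension of `R` that is constant on
rays; its differential at `n ∈ S²` is `dR_n` on `T_n S²` and vanishes on the normal vector `n`, so
that the condition is empty in the normal direction. -/
structure IsHolomorphic (R : S2 → S2) : Prop where
  smooth : ContDiffOn ℝ ∞ (rayExtension R) {0}ᶜ
  cauchyRiemann : ∀ (n : S2) (v : E3),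
    fderiv ℝ (rayExtension R) (n : E3) (cross n v) =
      cross (R n) (fderiv ℝ (rayExtension R) (n : E3) v)

end Skyrme

end

namespace Skyrme

/-! ### Integration by parts -/

/-! Along a curve of volume preserving diffeomorphisms with initial velocity `X`, `div X = 0`, the
energy has derivative `∫ ⟨φ^*g, DX⟩`, with `g` the round metric. For a suspension by a holomorphic
`R` with conformal factor `C`, the pulled back metric is `μ I + β x ⊗ x` with `β = f'² / r² - C sin²
f / r⁴` (`inner_diff_suspension`). The `μ` term drops out against `div X = 0`. With `u = ⟨x, X⟩` and
`E = x · ∇`, what remains is `∫ β (E u - u)`, formally `-∫ (E β + 4 β) u` (`firstVariation_eq`,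
`integral_mul_euler_sub_self`).

For the hedgehog `C = 1`, so `E β + 4 β` is radial. A radial multiple of `x` is a gradient, hence
orthogonal to every divergence free field of compact support, and the variation vanishes. The
integration by parts is not available for the actual `β`, which may be singular at the origin. It is
done for smooth functions of `|x|²`, and uniqueness of characteristic functions carries the result
to all measurable radial coefficients with integrable pairing. The degree is the integral of an
exact derivative in `r`. A profile equal to `kπ` near the origin and to zero far out makes the
hedgehog smooth and gives every degree.

For rigidity, test with rotations about an axis through a point `c ≠ 0`, cut off to a small ball.
Criticality says that `E β + 4 β` has no derivative at `c` tangent to the sphere through `c`. Only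
`C` varies tangentially, and its coefficient is `-(sin² f)' / r³`. Hence either `sin² f` is
constant, which forces `f = 0`, or `C` is constant (`conformalFactor_const_of_restrictedHarmonic`).

If `C = c > 0` is constant, `R` along a unit speed great circle solves `y'' = -c y`
(`second_fderiv_self`). Closing up at the antipode gives `sin (√c π) = 0`, and `√c > 1` would
collapse a circle of latitude, so `c = 1`. The same equation then shows that `R` is the restriction
of a linear isometry, which has determinant one because `R` is holomorphic. -/

theorem integral_fderiv_apply_eq_zero {Y : E3 → ℝ} (hY : ContDiff ℝ 1 Y)
    (hc : HasCompactSupport Y) (v : E3) : ∫ x, fderiv ℝ Y x v = 0 := by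
  have hi : Integrable (fun x => fderiv ℝ Y x v) :=
    ((hY.continuous_fderiv one_ne_zero).clm_apply continuous_const).integrable_of_hasCompactSupport
      (hc.fderiv_apply ℝ v)
  have h := integral_mul_fderiv_eq_neg_fderiv_mul_of_integrable (μ := (volume : Measure E3))
    (𝕜 := ℝ) (f := fun _ => (1 : ℝ)) (g := Y) (v := v) (by simp) (by simpa using hi)
    (by simpa using hY.continuous.integrable_of_hasCompactSupport hc)
    (fun x _ => by fun_prop) (fun x _ => (hY.differentiable one_ne_zero) x)
  simpa using h

/-- The divergence of a vector field on `ℝ³`. -/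
noncomputable def divergence (X : E3 → E3) (x : E3) : ℝ := ∑ i, fderiv ℝ X x (basisVec i) i

theorem fderiv_coord {X : E3 → E3} {x : E3} (hX : DifferentiableAt ℝ X x) (v : E3) (i : Fin 3) :
    fderiv ℝ (fun y => X y i) x v = fderiv ℝ X x v i := by
  have := ((EuclideanSpace.proj i : E3 →L[ℝ] ℝ).hasFDerivAt.comp x
    hX.hasFDerivAt).fderiv
  simpa [Function.comp_def] using congrArg (fun L => L v) this

theorem integral_divergence_eq_zero {X : E3 → E3} (hX : ContDiff ℝ 1 X)
    (hc : HasCompactSupport X) : ∫ x, divergence X x = 0 := by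
  have hXi : ∀ i : Fin 3, ContDiff ℝ 1 (fun y => X y i) := fun i => by fun_prop
  have hci : ∀ i : Fin 3, HasCompactSupport (fun y => X y i) := fun i =>
    hc.comp_left (g := fun v : E3 => v i) rfl
  have h : ∀ x, divergence X x = ∑ i, fderiv ℝ (fun y => X y i) x (basisVec i) := fun x => by
    simp only [divergence, fderiv_coord (hX.differentiable one_ne_zero x)]
  simp only [h]
  rw [integral_finsetSum]
  · exact Finset.sum_eq_zero fun i _ => integral_fderiv_apply_eq_zero (hXi i) (hci i) _
  · intro i _
    exact (((hXi i).continuous_fderiv one_ne_zero).clm_apply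
      continuous_const).integrable_of_hasCompactSupport ((hci i).fderiv_apply ℝ _)

theorem sum_basisVec (v : E3) : ∑ i, v i • basisVec i = v := by
  ext j
  fin_cases j <;> simp [basisVec, Fin.sum_univ_three]

theorem divergence_smul {g : E3 → ℝ} {X : E3 → E3} {x : E3} (hg : DifferentiableAt ℝ g x)
    (hX : DifferentiableAt ℝ X x) :
    divergence (fun y => g y • X y) x = fderiv ℝ g x (X x) + g x * divergence X x := by
  have h : fderiv ℝ g x (X x) = ∑ i, X x i * fderiv ℝ g x (basisVec i) := by
    conv_lhs => rw [← sum_basisVec (X x)]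
    simp
  rw [h]
  simp only [divergence, fderiv_fun_smul hg hX, Finset.mul_sum, ← Finset.sum_add_distrib]
  refine Finset.sum_congr rfl fun i _ => ?_
  simp
  ring

theorem divergence_id (x : E3) : divergence (fun y => y) x = 3 := by
  simp [divergence, basisVec]

theorem integral_fderiv_apply_add_mul_divergence {g : E3 → ℝ} {X : E3 → E3} {V : Set E3}
    (hV : IsOpen V) (hg : ContDiffOn ℝ 1 g V) (hX : ContDiff ℝ 1 X) (hc : HasCompactSupport X)
    (hXV : tsupport X ⊆ V) :
    ∫ x, (fderiv ℝ g x (X x) + g x * divergence X x) = 0 := by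
  have hY : ContDiff ℝ 1 (fun y => g y • X y) := by
    rw [contDiff_iff_contDiffAt]
    intro x
    by_cases hx : x ∈ tsupport X
    · exact ((hg x (hXV hx)).contDiffAt (hV.mem_nhds (hXV hx))).smul hX.contDiffAt
    · have h0 : X =ᶠ[𝓝 x] 0 := notMem_tsupport_iff_eventuallyEq.1 hx
      refine (contDiffAt_const (c := (0 : E3))).congr_of_eventuallyEq ?_
      filter_upwards [h0] with y hy
      simp [hy]
  rw [← integral_divergence_eq_zero hY (hc.smul_left (f := g))]
  refine integral_congr_ae (Eventually.of_forall fun x => ?_)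
  dsimp only
  by_cases hx : x ∈ tsupport X
  · rw [divergence_smul
      (((hg x (hXV hx)).contDiffAt (hV.mem_nhds (hXV hx))).differentiableAt one_ne_zero)
      (hX.differentiable one_ne_zero x)]
  · have h0 : X =ᶠ[𝓝 x] 0 := notMem_tsupport_iff_eventuallyEq.1 hx
    have h1 : (fun y => g y • X y) =ᶠ[𝓝 x] fun _ => 0 := by
      filter_upwards [h0] with y hy
      simp [hy]
    simp [divergence, h0.fderiv_eq, h1.fderiv_eq, h0.self_of_nhds]

/-- The radial component `⟪x, X⟫` of a vector field. -/
noncomputable def radialPart (X : E3 → E3) (x : E3) : ℝ := inner ℝ x (X x)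

/-- `2 Y(|x|²) x` is the gradient of `Z(|x|²)` for a primitive `Z` of `Y`, and gradients integrate
to zero against divergence free fields of compact support. -/
theorem integral_comp_normSq_mul_radialPart {X : E3 → E3} (hX : ContDiff ℝ 1 X)
    (hc : HasCompactSupport X) (hdiv : ∀ x, divergence X x = 0) {Y : ℝ → ℝ}
    (hY : Continuous Y) : ∫ x, Y (‖x‖ ^ 2) * radialPart X x = 0 := by
  set Z : ℝ → ℝ := fun s => ∫ t in (0)..s, Y t with hZ
  have hZd : ∀ s, HasDerivAt Z (Y s) s := fun s => hY.integral_hasStrictDerivAt 0 s |>.hasDerivAt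
  have hZ1 : ContDiff ℝ 1 Z := by
    rw [contDiff_one_iff_deriv]
    exact ⟨fun s => (hZd s).differentiableAt, by simpa [funext fun s => (hZd s).deriv] using hY⟩
  have hg : ContDiff ℝ 1 (fun x : E3 => Z (‖x‖ ^ 2)) := hZ1.comp (contDiff_norm_sq ℝ)
  have h := integral_fderiv_apply_add_mul_divergence isOpen_univ hg.contDiffOn hX hc (subset_univ _)
  have h2 : ∀ x, fderiv ℝ (fun x : E3 => Z (‖x‖ ^ 2)) x (X x)
      + Z (‖x‖ ^ 2) * divergence X x = 2 * (Y (‖x‖ ^ 2) * radialPart X x) := by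
    intro x
    have h3 := (hZd (‖x‖ ^ 2)).comp_hasFDerivAt x (hasStrictFDerivAt_norm_sq x).hasFDerivAt
    have h4 : fderiv ℝ (fun x : E3 => Z (‖x‖ ^ 2)) x = _ := h3.fderiv
    rw [h4, hdiv]
    simp [radialPart]
    ring
  simp only [h2, integral_const_mul] at h
  simpa using h

/-- Since `div (u x) = E u + 3 u` with `E = x · ∇`, the formal adjoint of `E - 1` is `-(E + 4)`.
Regularity of `β` is needed only on `V`, so `β` may be singular at the origin when `u` is supported
away from it. -/
theorem integral_mul_euler_sub_self {V : Set E3} (hV : IsOpen V) {β u : E3 → ℝ}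
    (hβ : ContDiffOn ℝ 1 β V) (hu : ContDiff ℝ 1 u) (hc : HasCompactSupport u)
    (huV : tsupport u ⊆ V) :
    ∫ x, β x * (fderiv ℝ u x x - u x) = - ∫ x, (fderiv ℝ β x x + 4 * β x) * u x := by
  have hX : ContDiff ℝ 1 (fun x : E3 => u x • x) := hu.smul contDiff_id
  have hcX : HasCompactSupport (fun x : E3 => u x • x) := hc.smul_right
  have hsub : tsupport (fun x : E3 => u x • x) ⊆ tsupport u :=
    closure_mono (Function.support_smul_subset_left u id)
  have h := integral_fderiv_apply_add_mul_divergence hV hβ hX hcX (hsub.trans huV)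
  have hcont : ∀ {g : E3 → ℝ}, ContinuousOn g V → HasCompactSupport g → tsupport g ⊆ V →
      Integrable g := fun {g} hg hgc hgV => by
    refine Continuous.integrable_of_hasCompactSupport ?_ hgc
    rw [continuous_iff_continuousAt]
    intro x
    by_cases hx : x ∈ tsupport g
    · exact hg.continuousAt (hV.mem_nhds (hgV hx))
    · have h0 : g =ᶠ[𝓝 x] fun _ => 0 := notMem_tsupport_iff_eventuallyEq.1 hx
      exact continuousAt_const.congr h0.symm
  have hdβ : ContinuousOn (fun x => fderiv ℝ β x x) V :=
    (hβ.continuousOn_fderiv_of_isOpen hV le_rfl).clm_apply continuousOn_id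
  have hdu : Continuous (fun x => fderiv ℝ u x x) :=
    (hu.continuous_fderiv one_ne_zero).clm_apply continuous_id
  have hcdu : HasCompactSupport (fun x => fderiv ℝ u x x - u x) := by
    refine hc.mono' ?_
    intro x hx
    by_contra hxu
    have h0 : u =ᶠ[𝓝 x] fun _ => 0 := notMem_tsupport_iff_eventuallyEq.1 hxu
    exact hx (by simp [h0.fderiv_eq, h0.self_of_nhds])
  have hsdu : tsupport (fun x => fderiv ℝ u x x - u x) ⊆ tsupport u := by
    refine closure_minimal ?_ (isClosed_tsupport u)
    intro x hx
    by_contra hxu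
    have h0 : u =ᶠ[𝓝 x] fun _ => 0 := notMem_tsupport_iff_eventuallyEq.1 hxu
    exact hx (by simp [h0.fderiv_eq, h0.self_of_nhds])
  have hi1 : Integrable (fun x => β x * (fderiv ℝ u x x - u x)) :=
    hcont (hβ.continuousOn.mul (hdu.sub hu.continuous).continuousOn) hcdu.mul_left
      ((tsupport_mul_subset_right).trans (hsdu.trans huV))
  have hi2 : Integrable (fun x => (fderiv ℝ β x x + 4 * β x) * u x) :=
    hcont ((hdβ.add (continuousOn_const.mul hβ.continuousOn)).mul hu.continuous.continuousOn)
      hc.mul_left ((tsupport_mul_subset_right).trans huV)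
  rw [eq_neg_iff_add_eq_zero, ← integral_add hi1 hi2, ← h]
  refine integral_congr_ae (Eventually.of_forall fun x => ?_)
  dsimp only
  rw [divergence_smul (X := fun y => y) (hu.differentiable one_ne_zero x) differentiableAt_id, divergence_id]
  simp
  ring

/-- The hypotheses say that the image under `N` of the signed measure `w μ` has zero Fourier
transform. The images of its positive and negative parts are finite measures with equal
characteristic functions, hence equal. This passes from smooth bounded test functions to arbitrary
measurable `b` without any cutoff near a singularity of `b`. -/
theorem integral_comp_mul_eq_zero_of_cos_sin {α : Type*} [MeasurableSpace α] {μ : Measure α}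
    {w N : α → ℝ} (hw : Measurable w) (hwi : Integrable w μ) (hN : Measurable N)
    (hcos : ∀ ξ : ℝ, ∫ x, Real.cos (ξ * N x) * w x ∂μ = 0)
    (hsin : ∀ ξ : ℝ, ∫ x, Real.sin (ξ * N x) * w x ∂μ = 0)
    {b : ℝ → ℝ} (hb : Measurable b) (hbi : Integrable (fun x => b (N x) * w x) μ) :
    ∫ x, b (N x) * w x ∂μ = 0 := by
  have hp : Measurable fun x => (w x).toNNReal := hw.real_toNNReal
  have hm : Measurable fun x => (-w x).toNNReal := hw.neg.real_toNNReal
  have hsplit : ∀ x, w x = ((w x).toNNReal : ℝ) - ((-w x).toNNReal : ℝ) := fun x => by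
    simp [Real.coe_toNNReal']
  have habs : ∀ x, ((w x).toNNReal : ℝ) ≤ |w x| ∧ ((-w x).toNNReal : ℝ) ≤ |w x| := fun x => by
    simp [Real.coe_toNNReal', le_abs_self, neg_le_abs]
  have hI : ∀ {g : α → ℝ}, Measurable g → Integrable (fun x => g x * w x) μ →
      Integrable (fun x => ((w x).toNNReal : ℝ) * g x) μ ∧
      Integrable (fun x => ((-w x).toNNReal : ℝ) * g x) μ := fun {g} hg hi => by
    constructor
    · refine hi.mono (by fun_prop) (Eventually.of_forall fun x => ?_)
      simp only [norm_mul, Real.norm_eq_abs, NNReal.abs_eq]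
      rw [mul_comm]
      exact mul_le_mul_of_nonneg_left (habs x).1 (abs_nonneg _)
    · refine hi.mono (by fun_prop) (Eventually.of_forall fun x => ?_)
      simp only [norm_mul, Real.norm_eq_abs, NNReal.abs_eq]
      rw [mul_comm]
      exact mul_le_mul_of_nonneg_left (habs x).2 (abs_nonneg _)
  set ν₁ : Measure ℝ := (μ.withDensity fun x => ((w x).toNNReal : ENNReal)).map N with hν₁
  set ν₂ : Measure ℝ := (μ.withDensity fun x => ((-w x).toNNReal : ENNReal)).map N with hν₂
  have hν₁f : IsFiniteMeasure (μ.withDensity fun x => ((w x).toNNReal : ENNReal)) :=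
    isFiniteMeasure_withDensity_ofReal hwi.2
  have hν₂f : IsFiniteMeasure (μ.withDensity fun x => ((-w x).toNNReal : ENNReal)) :=
    isFiniteMeasure_withDensity_ofReal hwi.neg.2
  have hint₁ : ∀ g : ℝ → ℝ, Measurable g → ∫ s, g s ∂ν₁ = ∫ x, ((w x).toNNReal : ℝ) * g (N x) ∂μ :=
    fun g hg => by
      rw [hν₁, integral_map hN.aemeasurable hg.aestronglyMeasurable,
        integral_withDensity_eq_integral_smul hp]
      rfl
  have hint₂ : ∀ g : ℝ → ℝ, Measurable g → ∫ s, g s ∂ν₂ = ∫ x, ((-w x).toNNReal : ℝ) * g (N x) ∂μ :=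
    fun g hg => by
      rw [hν₂, integral_map hN.aemeasurable hg.aestronglyMeasurable,
        integral_withDensity_eq_integral_smul hm]
      rfl
  have hdiff : ∀ g : ℝ → ℝ, Measurable g → Integrable (fun x => g (N x) * w x) μ →
      ∫ s, g s ∂ν₁ - ∫ s, g s ∂ν₂ = ∫ x, g (N x) * w x ∂μ := fun g hg hi => by
    obtain ⟨h1, h2⟩ := hI (hg.comp hN) hi
    rw [hint₁ g hg, hint₂ g hg]
    refine (integral_sub h1 h2).symm.trans (integral_congr_ae (Eventually.of_forall fun x => ?_))
    dsimp only [Function.comp]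
    rw [← sub_mul, ← hsplit, mul_comm]
  have hbdd : ∀ g : ℝ → ℝ, Measurable g → (∀ s, |g s| ≤ 1) →
      Integrable (fun x => g (N x) * w x) μ := fun g hg h1 =>
    hwi.bdd_mul (c := 1) (hg.comp hN).aestronglyMeasurable (Eventually.of_forall fun x => h1 _)
  have hν : ν₁ = ν₂ := by
    have : IsFiniteMeasure ν₁ := by rw [hν₁]; infer_instance
    have : IsFiniteMeasure ν₂ := by rw [hν₂]; infer_instance
    refine Measure.ext_of_charFun (funext fun ξ => ?_)
    have hc : ∀ s, |Real.cos (ξ * s)| ≤ 1 := fun s => Real.abs_cos_le_one _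
    have hs : ∀ s, |Real.sin (ξ * s)| ≤ 1 := fun s => Real.abs_sin_le_one _
    have h1 := hdiff (fun s => Real.cos (ξ * s)) (by fun_prop) (hbdd _ (by fun_prop) hc)
    have h2 := hdiff (fun s => Real.sin (ξ * s)) (by fun_prop) (hbdd _ (by fun_prop) hs)
    rw [hcos, sub_eq_zero] at h1
    rw [hsin, sub_eq_zero] at h2
    have hchar : ∀ ν : Measure ℝ, IsFiniteMeasure ν → charFun ν ξ =
        ((∫ s, Real.cos (ξ * s) ∂ν : ℝ) : ℂ) + ((∫ s, Real.sin (ξ * s) ∂ν : ℝ) : ℂ) * Complex.I := by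
      intro ν _
      have hic : Integrable (fun s => ((Real.cos (ξ * s) : ℝ) : ℂ)) ν :=
        Integrable.ofReal
          (Integrable.of_bound (C := 1) (f := fun s => Real.cos (ξ * s))
            (Continuous.aestronglyMeasurable (by fun_prop)) (Eventually.of_forall hc))
      have his : Integrable (fun s => ((Real.sin (ξ * s) : ℝ) : ℂ) * Complex.I) ν :=
        Integrable.ofReal
          (Integrable.of_bound (C := 1) (f := fun s => Real.sin (ξ * s))
            (Continuous.aestronglyMeasurable (by fun_prop)) (Eventually.of_forall hs)) |>.mul_const _
      rw [charFun_apply_real, ← integral_complex_ofReal, ← integral_complex_ofReal,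
        ← integral_mul_const, ← integral_add hic his]
      refine integral_congr_ae (Eventually.of_forall fun s => ?_)
      dsimp only
      rw [← Complex.ofReal_mul, Complex.exp_mul_I]
      push_cast
      rfl
    rw [hchar _ inferInstance, hchar _ inferInstance, h1, h2]
  rw [← hdiff b hb hbi, hν, sub_self]

theorem contDiff_radialPart {X : E3 → E3} (hX : ContDiff ℝ ∞ X) : ContDiff ℝ ∞ (radialPart X) :=
  contDiff_id.inner ℝ hX

theorem hasCompactSupport_radialPart {X : E3 → E3} (hc : HasCompactSupport X) :
    HasCompactSupport (radialPart X) :=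
  hc.mono fun x hx h => hx (by simp [radialPart, h])

/-- A divergence free vector field is orthogonal to `div (b x ⊗ x)` for every radial function `b`,
provided the pairing makes sense. -/
theorem integral_radial_mul_euler_radialPart_eq_zero {X : E3 → E3} (hX : ContDiff ℝ ∞ X)
    (hc : HasCompactSupport X) (hdiv : ∀ x, divergence X x = 0) {b : ℝ → ℝ} (hb : Measurable b)
    (hbi : Integrable fun x => b ‖x‖ * (fderiv ℝ (radialPart X) x x - radialPart X x)) :
    ∫ x, b ‖x‖ * (fderiv ℝ (radialPart X) x x - radialPart X x) = 0 := by
  have hu := contDiff_radialPart hX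
  have huc := hasCompactSupport_radialPart hc
  have hw : Continuous fun x => fderiv ℝ (radialPart X) x x - radialPart X x :=
    ((hu.continuous_fderiv (by simp)).clm_apply continuous_id).sub hu.continuous
  have hwc : HasCompactSupport fun x => fderiv ℝ (radialPart X) x x - radialPart X x := by
    refine huc.mono' fun x hx => ?_
    by_contra hxu
    have h0 : radialPart X =ᶠ[𝓝 x] fun _ => 0 := notMem_tsupport_iff_eventuallyEq.1 hxu
    exact hx (by simp [h0.fderiv_eq, h0.self_of_nhds])
  -- A smooth function of `|x|²` is smooth at the origin too, so the adjoint formula holds on all of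
  -- space, and `(E + 4) T(|x|²)` is again a continuous function of `|x|²`.
  have htest : ∀ T : ℝ → ℝ, ContDiff ℝ ∞ T →
      ∫ x : E3, T (‖x‖ ^ 2) * (fderiv ℝ (radialPart X) x x - radialPart X x) = 0 := by
    intro T hT
    have hβ : ContDiff ℝ 1 (fun x : E3 => T (‖x‖ ^ 2)) :=
      (hT.of_le (by simp)).comp (contDiff_norm_sq ℝ)
    rw [integral_mul_euler_sub_self isOpen_univ hβ.contDiffOn (hu.of_le (by simp)) huc
      (subset_univ _), neg_eq_zero]
    have hT' : Continuous (deriv T) := hT.continuous_deriv (by simp)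
    have h := integral_comp_normSq_mul_radialPart (hX.of_le (by simp)) hc hdiv
      (Y := fun s => 2 * s * deriv T s + 4 * T s)
      (by have := hT.continuous; fun_prop)
    rw [← h]
    refine integral_congr_ae (Eventually.of_forall fun x => ?_)
    have h3 := ((hT.differentiable (by simp) (‖x‖ ^ 2)).hasDerivAt).comp_hasFDerivAt x
      (hasStrictFDerivAt_norm_sq x).hasFDerivAt
    have h4 : fderiv ℝ (fun x : E3 => T (‖x‖ ^ 2)) x = _ := h3.fderiv
    dsimp only
    rw [h4]
    simp only [smul_apply, innerSL_apply_apply, real_inner_self_eq_norm_sq,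
      smul_eq_mul, nsmul_eq_mul]
    push_cast
    ring
  have h := integral_comp_mul_eq_zero_of_cos_sin (μ := (volume : Measure E3))
    (N := fun x => ‖x‖ ^ 2) (b := fun s => b (Real.sqrt s)) hw.measurable
    (hw.integrable_of_hasCompactSupport hwc) (by fun_prop)
    (fun ξ => htest (fun s => Real.cos (ξ * s)) (by fun_prop))
    (fun ξ => htest (fun s => Real.sin (ξ * s)) (by fun_prop)) (hb.comp Real.continuous_sqrt.measurable)
    (by simpa using hbi)
  simpa using h

/-! ### Curves of volume preserving diffeomorphisms -/

/-- By the inverse function theorem `f` has a smooth local inverse near each point, and it must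
agree with the given global one. Used for joint smoothness of `ψ_t⁻¹(x)` in `(t, x)`. -/
theorem contDiff_of_inverse {E : Type*} [NormedAddCommGroup E] [NormedSpace ℝ E]
    [FiniteDimensional ℝ E] {f g : E → E} (hf : ContDiff ℝ ∞ f) (hgf : ∀ x, g (f x) = x)
    (hfg : ∀ y, f (g y) = y) (hinj : ∀ x, Function.Injective (fderiv ℝ f x)) :
    ContDiff ℝ ∞ g := by
  have : CompleteSpace E := FiniteDimensional.complete ℝ E
  rw [contDiff_iff_contDiffAt]
  intro y
  set a := g y with ha
  set e : E ≃L[ℝ] E := (LinearEquiv.ofInjectiveEndo (fderiv ℝ f a : E →ₗ[ℝ] E)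
    (hinj a)).toContinuousLinearEquiv with he
  have hef : (e : E →L[ℝ] E) = fderiv ℝ f a := by ext v; rfl
  have hd : HasFDerivAt f (e : E →L[ℝ] E) a := by
    rw [hef]; exact (hf.differentiable (by simp) a).hasFDerivAt
  have hfa : ContDiffAt ℝ ∞ f a := hf.contDiffAt
  have h1 := hfa.to_localInverse hd (by simp)
  have h2 := (hfa.hasStrictFDerivAt' hd (by simp)).localInverse_unique
    (Eventually.of_forall hgf)
  have h3 := h1.congr_of_eventuallyEq h2
  rwa [ha, hfg] at h3

theorem det_eq_matrix_det (L : E3 →L[ℝ] E3) :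
    L.det = Matrix.det (Matrix.of fun i j => L (basisVec j) i) := by
  rw [ContinuousLinearMap.det, ← LinearMap.det_toMatrix (EuclideanSpace.basisFun (Fin 3) ℝ).toBasis]
  congr 1

variable {U : Set E3} {ψ : ℝ → (E3 ≃ₘ[ℝ] E3)}

namespace IsSDiffCurve

/-- The initial velocity of a curve of diffeomorphisms. -/
noncomputable def velocity (ψ : ℝ → (E3 ≃ₘ[ℝ] E3)) (x : E3) : E3 :=
  fderiv ℝ (fun p : ℝ × E3 => ψ p.1 p.2) (0, x) (1, 0)

/-- The spatial differential `Dψ_t(x)`. -/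
noncomputable def spaceDeriv (ψ : ℝ → (E3 ≃ₘ[ℝ] E3)) (p : ℝ × E3) : E3 →L[ℝ] E3 :=
  (fderiv ℝ (fun p : ℝ × E3 => ψ p.1 p.2) p).comp (ContinuousLinearMap.inr ℝ ℝ E3)

/-- The spatial differential of `ψ_t` at the preimage of a point. -/
noncomputable def pulledDeriv (ψ : ℝ → (E3 ≃ₘ[ℝ] E3)) (p : ℝ × E3) : E3 →L[ℝ] E3 :=
  spaceDeriv ψ (p.1, (ψ p.1).symm p.2)

theorem spaceDeriv_eq (h : IsSDiffCurve U ψ) (t : ℝ) (x : E3) :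
    spaceDeriv ψ (t, x) = fderiv ℝ (ψ t) x := by
  have h1 : HasFDerivAt (fun y : E3 => (t, y)) (ContinuousLinearMap.inr ℝ ℝ E3) x :=
    hasFDerivAt_prodMk_right t x
  have h2 := ((h.smooth.differentiable (by simp) (t, x)).hasFDerivAt).comp x h1
  exact h2.fderiv.symm

theorem contDiff_spaceDeriv (h : IsSDiffCurve U ψ) : ContDiff ℝ ∞ (spaceDeriv ψ) := by
  have h1 : ContDiff ℝ ∞ (fderiv ℝ (fun p : ℝ × E3 => ψ p.1 p.2)) :=
    h.smooth.fderiv_right (by simp)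
  exact h1.clm_comp contDiff_const

theorem injective_fderiv (h : IsSDiffCurve U ψ) (t : ℝ) (x : E3) :
    Function.Injective (fderiv ℝ (ψ t) x) := by
  have h1 : LinearMap.det (fderiv ℝ (ψ t) x : E3 →ₗ[ℝ] E3) ≠ 0 := by
    have := h.volume_preserving t x
    rw [ContinuousLinearMap.det] at this
    rw [this]; exact one_ne_zero
  have := (LinearMap.equivOfDetNeZero _ h1).injective
  exact this

theorem contDiff_symm (h : IsSDiffCurve U ψ) :
    ContDiff ℝ ∞ (fun p : ℝ × E3 => (ψ p.1).symm p.2) := by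
  -- The differential of `(t, x) ↦ (t, ψ_t x)` is block triangular with diagonal blocks `1` and
  -- `Dψ_t`, hence injective.
  have hΨ : ContDiff ℝ ∞ (fun p : ℝ × E3 => (p.1, ψ p.1 p.2)) := contDiff_fst.prodMk h.smooth
  have hg := contDiff_of_inverse (g := fun p : ℝ × E3 => (p.1, (ψ p.1).symm p.2)) hΨ
    (fun p => by simp) (fun p => by simp) ?_
  · exact hg.snd
  · rintro ⟨t, x⟩
    have hd : fderiv ℝ (fun p : ℝ × E3 => (p.1, ψ p.1 p.2)) (t, x) =
        (ContinuousLinearMap.fst ℝ ℝ E3).prod (fderiv ℝ (fun p : ℝ × E3 => ψ p.1 p.2) (t, x)) :=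
      (hasFDerivAt_fst.prodMk
        (h.smooth.differentiable (by simp) (t, x)).hasFDerivAt).fderiv
    rw [hd, injective_iff_map_eq_zero]
    rintro ⟨s, v⟩ hsv
    simp only [ContinuousLinearMap.prod_apply, ContinuousLinearMap.coe_fst', Prod.mk_eq_zero] at hsv
    obtain ⟨rfl, hv⟩ := hsv
    have h2 : fderiv ℝ (ψ t) x v = 0 := by
      rw [← h.spaceDeriv_eq]; exact hv
    have := (injective_iff_map_eq_zero _).1 (h.injective_fderiv t x) v h2
    simp [this]

theorem contDiff_pulledDeriv (h : IsSDiffCurve U ψ) : ContDiff ℝ ∞ (pulledDeriv ψ) :=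
  h.contDiff_spaceDeriv.comp (contDiff_fst.prodMk h.contDiff_symm)

theorem contDiff_velocity (h : IsSDiffCurve U ψ) : ContDiff ℝ ∞ (velocity ψ) := by
  have h1 : ContDiff ℝ ∞ (fderiv ℝ (fun p : ℝ × E3 => ψ p.1 p.2)) :=
    h.smooth.fderiv_right (by simp)
  exact (h1.comp (contDiff_const.prodMk contDiff_id)).clm_apply contDiff_const

theorem hasDerivAt_velocity (h : IsSDiffCurve U ψ) (x : E3) :
    HasDerivAt (fun t => ψ t x) (velocity ψ x) 0 := by
  have h1 : HasDerivAt (fun t : ℝ => (t, x)) (1, 0) 0 :=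
    (hasDerivAt_id 0).prodMk (hasDerivAt_const 0 x)
  exact ((h.smooth.differentiable (by simp) (0, x)).hasFDerivAt).comp_hasDerivAt 0 h1

theorem hasCompactSupport_velocity (h : IsSDiffCurve U ψ) : HasCompactSupport (velocity ψ) := by
  obtain ⟨K, hK, -, hψ⟩ := h.support
  refine HasCompactSupport.intro hK fun x hx => ?_
  have h1 := h.hasDerivAt_velocity x
  have h2 : (fun t => ψ t x) = fun _ => x := funext fun t => hψ t x hx
  rw [h2] at h1
  exact h1.unique (hasDerivAt_const 0 x)

theorem spaceDeriv_zero (h : IsSDiffCurve U ψ) (x : E3) :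
    spaceDeriv ψ (0, x) = ContinuousLinearMap.id ℝ E3 := by
  rw [h.spaceDeriv_eq, show (ψ 0 : E3 → E3) = id from funext h.zero, fderiv_id]

theorem fderiv_spaceDeriv_zero_right (h : IsSDiffCurve U ψ) (x v : E3) :
    fderiv ℝ (spaceDeriv ψ) (0, x) (0, v) = 0 := by
  have h1 : HasFDerivAt (fun y : E3 => ((0 : ℝ), y)) (ContinuousLinearMap.inr ℝ ℝ E3) x :=
    hasFDerivAt_prodMk_right 0 x
  have h2 := ((h.contDiff_spaceDeriv.differentiable (by simp) (0, x)).hasFDerivAt).comp x h1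
  have h3 : (spaceDeriv ψ ∘ fun y : E3 => ((0 : ℝ), y)) =
      fun _ => ContinuousLinearMap.id ℝ E3 := funext fun y => h.spaceDeriv_zero y
  rw [h3] at h2
  simpa using (DFunLike.congr_fun (h2.unique (hasFDerivAt_const _ x)) v)

/-- Symmetry of the second derivative exchanges `∂_t` and the spatial differential. -/
theorem fderiv_spaceDeriv_zero_left (h : IsSDiffCurve U ψ) (x : E3) :
    fderiv ℝ (spaceDeriv ψ) (0, x) (1, 0) = fderiv ℝ (velocity ψ) x := by
  set F : ℝ × E3 → E3 := fun p => ψ p.1 p.2 with hF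
  have h1 : ContDiff ℝ ∞ (fderiv ℝ F) := h.smooth.fderiv_right (by simp)
  have hd : HasFDerivAt (fderiv ℝ F) (fderiv ℝ (fderiv ℝ F) (0, x)) (0, x) :=
    (h1.differentiable (by simp) _).hasFDerivAt
  have hsymm : IsSymmSndFDerivAt ℝ F (0, x) :=
    h.smooth.contDiffAt.isSymmSndFDerivAt (by simp; exact WithTop.coe_le_coe.2 le_top)
  ext1 v
  have h2 : fderiv ℝ (spaceDeriv ψ) (0, x) (1, 0) v = fderiv ℝ (fderiv ℝ F) (0, x) (1, 0) (0, v) := by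
    have h3 : HasFDerivAt (fun p => spaceDeriv ψ p v) _ (0, x) :=
      (hd.clm_apply (hasFDerivAt_const ((0 : ℝ), v) (0, x)))
    have h4 : HasFDerivAt (fun p => spaceDeriv ψ p v) _ (0, x) :=
      ((h.contDiff_spaceDeriv.differentiable (by simp) (0, x)).hasFDerivAt.clm_apply
        (hasFDerivAt_const v (0, x)))
    have h5 := DFunLike.congr_fun (h4.unique h3) ((1 : ℝ), (0 : E3))
    simpa using h5
  have h6 : fderiv ℝ (velocity ψ) x v = fderiv ℝ (fderiv ℝ F) (0, x) (0, v) (1, 0) := by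
    have h7 : HasFDerivAt (fun y : E3 => ((0 : ℝ), y)) (ContinuousLinearMap.inr ℝ ℝ E3) x :=
      hasFDerivAt_prodMk_right 0 x
    have h8 : HasFDerivAt (velocity ψ) _ x :=
      (hd.comp x h7).clm_apply (hasFDerivAt_const ((1 : ℝ), (0 : E3)) x)
    rw [h8.fderiv]
    simp
  rw [h2, h6]
  exact hsymm _ _

/-- The motion of the base point `ψ_t⁻¹(x)` contributes nothing at `t = 0`, because `Dψ_0` is the
identity everywhere and so has no spatial derivative. -/
theorem fderiv_pulledDeriv_zero (h : IsSDiffCurve U ψ) (x : E3) :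
    fderiv ℝ (pulledDeriv ψ) (0, x) (1, 0) = fderiv ℝ (velocity ψ) x := by
  have h1 : DifferentiableAt ℝ (fun p : ℝ × E3 => (ψ p.1).symm p.2) (0, x) :=
    h.contDiff_symm.differentiable (by simp) _
  have h0 : (ψ 0).symm x = x := by
    conv_lhs => rw [← h.zero x]
    simp
  have h2 : HasFDerivAt (spaceDeriv ψ) (fderiv ℝ (spaceDeriv ψ) (0, x)) (0, (ψ 0).symm x) := by
    rw [h0]
    exact (h.contDiff_spaceDeriv.differentiable (by simp) (0, x)).hasFDerivAt
  have h3 : HasFDerivAt (pulledDeriv ψ) _ (0, x) :=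
    h2.comp ((0 : ℝ), x) (hasFDerivAt_fst.prodMk h1.hasFDerivAt)
  rw [h3.fderiv, ← h.fderiv_spaceDeriv_zero_left]
  set z := fderiv ℝ (fun p : ℝ × E3 => (ψ p.1).symm p.2) (0, x) (1, 0) with hz
  have h4 : ((1 : ℝ), z) = (1, 0) + (0, z) := by simp
  have h5 := h.fderiv_spaceDeriv_zero_right x z
  simp only [ContinuousLinearMap.comp_apply, ContinuousLinearMap.prod_apply,
    ContinuousLinearMap.coe_fst', ← hz]
  rw [h4, map_add, h5, add_zero]

/-- The derivative of the determinant at the identity is the trace; it is applied to `det Dψ_t = 1`.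
-/
theorem divergence_velocity (h : IsSDiffCurve U ψ) (x : E3) : divergence (velocity ψ) x = 0 := by
  set m : Fin 3 → Fin 3 → ℝ → ℝ := fun i j t => spaceDeriv ψ (t, x) (basisVec j) i with hm
  have hdm : ∀ i j, HasDerivAt (m i j) (fderiv ℝ (velocity ψ) x (basisVec j) i) 0 := by
    intro i j
    have h1 : HasDerivAt (fun t : ℝ => (t, x)) (1, 0) 0 :=
      (hasDerivAt_id 0).prodMk (hasDerivAt_const 0 x)
    have h2 := ((h.contDiff_spaceDeriv.differentiable (by simp) (0, x)).hasFDerivAt).comp_hasDerivAt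
      0 h1
    rw [h.fderiv_spaceDeriv_zero_left] at h2
    have h3 := h2.clm_apply (hasDerivAt_const 0 (basisVec j))
    have h4 := ((EuclideanSpace.proj i : E3 →L[ℝ] ℝ).hasFDerivAt).comp_hasDerivAt 0 h3
    simpa [Function.comp_def] using h4
  have h0 : ∀ i j, m i j 0 = if i = j then 1 else 0 := fun i j => by
    simp [hm, h.spaceDeriv_zero, basisVec]
  have hdet : ∀ t, m 0 0 t * m 1 1 t * m 2 2 t - m 0 0 t * m 1 2 t * m 2 1 t
      - m 0 1 t * m 1 0 t * m 2 2 t + m 0 1 t * m 1 2 t * m 2 0 t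
      + m 0 2 t * m 1 0 t * m 2 1 t - m 0 2 t * m 1 1 t * m 2 0 t = 1 := fun t => by
    rw [← h.volume_preserving t x, ← h.spaceDeriv_eq, det_eq_matrix_det, Matrix.det_fin_three]
    rfl
  have hd := ((((((((hdm 0 0).mul (hdm 1 1)).mul (hdm 2 2)).sub
    (((hdm 0 0).mul (hdm 1 2)).mul (hdm 2 1))).sub
    (((hdm 0 1).mul (hdm 1 0)).mul (hdm 2 2))).add
    (((hdm 0 1).mul (hdm 1 2)).mul (hdm 2 0))).add
    (((hdm 0 2).mul (hdm 1 0)).mul (hdm 2 1))).sub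
    (((hdm 0 2).mul (hdm 1 1)).mul (hdm 2 0)))
  have hc : HasDerivAt (fun _ : ℝ => (1 : ℝ)) _ 0 := hd.congr_of_eventuallyEq
    (Eventually.of_forall fun t => (hdet t).symm)
  have := hc.unique (hasDerivAt_const 0 1)
  simp [h0] at this
  rw [divergence, Fin.sum_univ_three]
  linarith

theorem integral_comp (h : IsSDiffCurve U ψ) (t : ℝ) (g : E3 → ℝ) :
    ∫ x, g (ψ t x) = ∫ y, g y := by
  have h1 := integral_image_eq_integral_abs_det_fderiv_smul (volume : Measure E3) (s := univ)
    MeasurableSet.univ (f := ψ t) (f' := fderiv ℝ (ψ t))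
    (fun x _ => (((ψ t).contDiff.differentiable (by simp)) x).hasFDerivAt.hasFDerivWithinAt)
    (ψ t).injective.injOn g
  simpa [h.volume_preserving, image_univ, (ψ t).surjective.range_eq] using h1.symm

end IsSDiffCurve

/-! ### The first variation of the Dirichlet energy -/

/-- The differential of `φ`, as a map into the ambient `ℝ⁴`. -/
noncomputable def diff (φ : E3 → S3) (x : E3) : E3 →L[ℝ] E4 := fderiv ℝ (fun y => (φ y : E4)) x

theorem norm_diff_sq_le (φ : E3 → S3) (x : E3) : ‖diff φ x‖ ^ 2 ≤ 3 * energyDensity φ x := by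
  have h1 : ‖diff φ x‖ ≤ ∑ i, ‖partialD φ i x‖ := by
    refine ContinuousLinearMap.opNorm_le_bound _ (by positivity) fun v => ?_
    conv_lhs => rw [← sum_basisVec v]
    rw [map_sum, Finset.sum_mul]
    refine (norm_sum_le _ _).trans (Finset.sum_le_sum fun i _ => ?_)
    rw [map_smul, norm_smul, mul_comm]
    exact mul_le_mul_of_nonneg_left (PiLp.norm_apply_le v i) (norm_nonneg _)
  calc ‖diff φ x‖ ^ 2 ≤ (∑ i, ‖partialD φ i x‖) ^ 2 := by gcongr
    _ ≤ 3 * energyDensity φ x := by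
      have := sq_sum_le_card_mul_sum_sq (s := (Finset.univ : Finset (Fin 3)))
        (f := fun i => ‖partialD φ i x‖)
      simpa [energyDensity] using this

theorem energyDensity_nonneg (φ : E3 → S3) (x : E3) : 0 ≤ energyDensity φ x :=
  Finset.sum_nonneg fun _ _ => by positivity

theorem measurable_diff_apply (φ : E3 → S3) : Measurable fun p : E3 × E3 => diff φ p.1 p.2 := by
  have h : (fun p : E3 × E3 => diff φ p.1 p.2) =
      fun p => ∑ i, p.2 i • diff φ p.1 (basisVec i) := funext fun p => by
    conv_lhs => rw [← sum_basisVec p.2]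
    simp
  rw [h]
  refine Finset.measurable_fun_sum _ fun i _ => ?_
  have h1 : Measurable fun x => diff φ x (basisVec i) := measurable_fderiv_apply_const ℝ _ _
  have h2 : Measurable fun p : E3 × E3 => p.2 i :=
    (by fun_prop : Continuous fun p : E3 × E3 => p.2 i).measurable
  exact h2.smul (h1.comp measurable_fst)

/-- The first variation of the Dirichlet energy of `φ` along the vector field `X`. -/
noncomputable def firstVariation (φ : E3 → S3) (X : E3 → E3) (x : E3) : ℝ :=
  ∑ i, inner ℝ (diff φ x (basisVec i)) (diff φ x (fderiv ℝ X x (basisVec i)))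

theorem setIntegral_compl_zero (g : E3 → ℝ) : ∫ x in ({0}ᶜ : Set E3), g x = ∫ x, g x := by
  rw [Measure.restrict_eq_self_of_ae_mem]
  exact compl_mem_ae_iff.2 (measure_singleton 0)

theorem integrableOn_compl_zero {g : E3 → ℝ} : IntegrableOn g ({0}ᶜ : Set E3) ↔ Integrable g := by
  rw [IntegrableOn, Measure.restrict_eq_self_of_ae_mem]
  exact compl_mem_ae_iff.2 (measure_singleton 0)

theorem ae_ne_zero : ∀ᵐ x : E3, x ≠ 0 := compl_mem_ae_iff.2 (measure_singleton 0)

/-! ### Differentiating the energy along a curve of diffeomorphisms -/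

section

variable {U : Set E3} {ψ : ℝ → (E3 ≃ₘ[ℝ] E3)}

theorem SmoothOn.differentiableAt {φ : E3 → S3} (hφ : SmoothOn {0}ᶜ φ) {x : E3} (hx : x ≠ 0) :
    DifferentiableAt ℝ (fun y => (φ y : E4)) x :=
  ((hφ x hx).contDiffAt (isOpen_compl_singleton.mem_nhds hx)).differentiableAt (by simp)

/-- The substitution `y = ψ_t x` moves `t` from the argument of `dφ` into the factor `Dψ_t ∘ ψ_t⁻¹`.
For fixed `y` the new integrand is smooth in `t` although `φ` may fail to be smooth at the origin,
and no second derivative of `φ` ever appears. -/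
theorem dirichletEnergy_comp (h : IsSDiffCurve U ψ) {φ : E3 → S3} (hφ : SmoothOn {0}ᶜ φ) (t : ℝ) :
    dirichletEnergy univ (φ ∘ ψ t) =
      (1 / 2) * ∫ y, ∑ i, ‖diff φ y (IsSDiffCurve.pulledDeriv ψ (t, y) (basisVec i))‖ ^ 2 := by
  rw [dirichletEnergy, Measure.restrict_univ,
    ← h.integral_comp t fun y => ∑ i, ‖diff φ y (IsSDiffCurve.pulledDeriv ψ (t, y) (basisVec i))‖ ^ 2]
  congr 1
  have hne : ∀ᵐ x : E3, x ≠ (ψ t).symm 0 := compl_mem_ae_iff.2 (measure_singleton _)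
  refine integral_congr_ae (hne.mono fun x hx => ?_)
  have hx' : ψ t x ≠ 0 := fun h0 => hx (by rw [← h0, Diffeomorph.symm_apply_apply])
  have h1 : fderiv ℝ (fun y => ((φ ∘ ψ t) y : E4)) x =
      (diff φ (ψ t x)).comp (fderiv ℝ (ψ t) x) :=
    ((hφ.differentiableAt hx').hasFDerivAt.comp x
      ((ψ t).contDiff.differentiable (by simp) x).hasFDerivAt).fderiv
  simp only [energyDensity, partialD, h1, IsSDiffCurve.pulledDeriv,
    Diffeomorph.symm_apply_apply, h.spaceDeriv_eq]
  rfl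

/-- Differentiation under the integral sign. The integrand is quadratic in `dφ`, with coefficients
that are bounded for `|t| ≤ 1` on the compact support and constant in `t` off it. Hence its
`t`-derivative is dominated by a multiple of the energy density. -/
theorem hasDerivAt_dirichletEnergy_comp (h : IsSDiffCurve U ψ) {φ : E3 → S3}
    (hφ : SmoothOn {0}ᶜ φ) (hfin : Integrable (energyDensity φ)) :
    Integrable (firstVariation φ (IsSDiffCurve.velocity ψ)) ∧
    HasDerivAt (fun t => dirichletEnergy univ (φ ∘ ψ t))
      (∫ x, firstVariation φ (IsSDiffCurve.velocity ψ) x) 0 := by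
  set A := IsSDiffCurve.pulledDeriv ψ with hA
  have hAs : ContDiff ℝ ∞ A := h.contDiff_pulledDeriv
  set B : ℝ × E3 → E3 →L[ℝ] E3 := fun p => fderiv ℝ A p (1, 0) with hB
  have hBc : Continuous B := (hAs.continuous_fderiv (by simp)).clm_apply continuous_const
  have hAB : ∀ t y, HasDerivAt (fun t => A (t, y)) (B (t, y)) t := fun t y => by
    have h1 : HasDerivAt (fun t : ℝ => (t, y)) (1, 0) t :=
      (hasDerivAt_id t).prodMk (hasDerivAt_const t y)
    have h2 : HasFDerivAt A (fderiv ℝ A (t, y)) (t, y) :=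
      (hAs.differentiable (by simp) (t, y)).hasFDerivAt
    exact HasFDerivAt.comp_hasDerivAt (f := fun t => (t, y)) (l := A) t h2 h1
  obtain ⟨K, hK, -, hψ⟩ := h.support
  have hKo : ∀ t, ∀ y ∉ K, A (t, y) = ContinuousLinearMap.id ℝ E3 := by
    intro t y hy
    have h1 : (ψ t).symm y = y := by
      conv_lhs => rw [← hψ t y hy]
      simp
    have h2 : (ψ t : E3 → E3) =ᶠ[𝓝 y] id := by
      filter_upwards [hK.isClosed.isOpen_compl.mem_nhds hy] with z hz using hψ t z hz
    rw [hA, IsSDiffCurve.pulledDeriv]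
    dsimp only
    rw [h1, h.spaceDeriv_eq, h2.fderiv_eq, fderiv_id]
  have hB0 : ∀ t, ∀ y ∉ K, B (t, y) = 0 := fun t y hy => by
    have h1 := hAB t y
    rw [show (fun t => A (t, y)) = fun _ => ContinuousLinearMap.id ℝ E3 from
      funext fun s => hKo s y hy] at h1
    exact h1.unique (hasDerivAt_const _ _)
  obtain ⟨C, hC⟩ : ∃ C, ∀ p ∈ Icc (-1 : ℝ) 1 ×ˢ K, ‖A p‖ * ‖B p‖ ≤ C :=
    ((isCompact_Icc.prod hK).bddAbove_image
      ((hAs.continuous.norm.mul hBc.norm).continuousOn)).imp fun C hC p hp =>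
        hC (mem_image_of_mem _ hp)
  have hAB_le : ∀ t ∈ Icc (-1 : ℝ) 1, ∀ y, ‖A (t, y)‖ * ‖B (t, y)‖ ≤ max C 0 := by
    intro t ht y
    by_cases hy : y ∈ K
    · exact (hC (t, y) ⟨ht, hy⟩).trans (le_max_left _ _)
    · simp [hB0 t y hy]
  have hbv : ∀ i, ‖basisVec i‖ = 1 := fun i => by simp [basisVec]
  have hmeas : ∀ G : ℝ × E3 → E3 →L[ℝ] E3, Continuous G → ∀ t i,
      Measurable fun y => diff φ y (G (t, y) (basisVec i)) := fun G hG t i =>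
    (measurable_diff_apply φ).comp (measurable_id.prodMk
      (by fun_prop : Continuous fun y => G (t, y) (basisVec i)).measurable)
  have hkey := hasDerivAt_integral_of_dominated_loc_of_deriv_le (μ := (volume : Measure E3))
    (F := fun t y => ∑ i, ‖diff φ y (A (t, y) (basisVec i))‖ ^ 2)
    (F' := fun t y => ∑ i, 2 * inner ℝ (diff φ y (A (t, y) (basisVec i)))
      (diff φ y (B (t, y) (basisVec i))))
    (x₀ := (0 : ℝ)) (s := Icc (-1 : ℝ) 1)
    -- 18 is 3 summands, times 2 from differentiating a square, times the 3 of `norm_diff_sq_le`.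
    (bound := fun y => 18 * (max C 0) * energyDensity φ y)
    (Icc_mem_nhds (by norm_num) (by norm_num))
    (Eventually.of_forall fun t => (Finset.measurable_fun_sum _ fun i _ =>
      ((hmeas A hAs.continuous t i).norm.pow_const 2)).aestronglyMeasurable)
    (by
      refine hfin.congr (Eventually.of_forall fun y => ?_)
      have h0 : A (0, y) = ContinuousLinearMap.id ℝ E3 := by
        rw [hA, IsSDiffCurve.pulledDeriv]
        exact h.spaceDeriv_zero _
      simp [energyDensity, partialD, h0, diff])
    ((Finset.measurable_fun_sum _ fun i _ =>
      ((hmeas A hAs.continuous 0 i).inner (hmeas B hBc 0 i)).const_mul 2).aestronglyMeasurable)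
    (Eventually.of_forall fun y t ht => by
      have hi : ∀ i, ‖2 * inner ℝ (diff φ y (A (t, y) (basisVec i)))
          (diff φ y (B (t, y) (basisVec i)))‖ ≤ 6 * max C 0 * energyDensity φ y := by
        intro i
        rw [norm_mul, Real.norm_ofNat]
        have h1 := norm_inner_le_norm (𝕜 := ℝ) (diff φ y (A (t, y) (basisVec i)))
          (diff φ y (B (t, y) (basisVec i)))
        have h2 : ∀ M : E3 →L[ℝ] E3, ‖diff φ y (M (basisVec i))‖ ≤ ‖diff φ y‖ * ‖M‖ := fun M => by
          refine ((diff φ y).le_opNorm _).trans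
            (mul_le_mul_of_nonneg_left ?_ (norm_nonneg _))
          simpa [hbv] using M.le_opNorm (basisVec i)
        have h3 : ‖diff φ y (A (t, y) (basisVec i))‖ * ‖diff φ y (B (t, y) (basisVec i))‖ ≤
            (‖diff φ y‖ * ‖A (t, y)‖) * (‖diff φ y‖ * ‖B (t, y)‖) :=
          mul_le_mul (h2 _) (h2 _) (norm_nonneg _) (by positivity)
        have h4 : (‖diff φ y‖ * ‖A (t, y)‖) * (‖diff φ y‖ * ‖B (t, y)‖) ≤
            (3 * energyDensity φ y) * max C 0 := by
          calc _ = ‖diff φ y‖ ^ 2 * (‖A (t, y)‖ * ‖B (t, y)‖) := by ring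
            _ ≤ _ := mul_le_mul (norm_diff_sq_le φ y) (hAB_le t ht y) (by positivity)
              (by have := energyDensity_nonneg φ y; positivity)
        linarith
      refine (norm_sum_le _ _).trans ((Finset.sum_le_sum fun i _ => hi i).trans ?_)
      simp
      linarith)
    (hfin.const_mul _)
    (Eventually.of_forall fun y t _ => by
      refine HasDerivAt.fun_sum fun i _ => ?_
      have h1 : HasDerivAt (fun t => diff φ y (A (t, y) (basisVec i)))
          (diff φ y (B (t, y) (basisVec i))) t := by
        have h2 := (hAB t y).clm_apply (hasDerivAt_const t (basisVec i))
        have h3 := (diff φ y).hasFDerivAt.comp_hasDerivAt t h2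
        simp only [map_zero, add_zero] at h3
        exact h3
      exact h1.norm_sq)
  have hF' : ∀ y, (∑ i, 2 * inner ℝ (diff φ y (A (0, y) (basisVec i)))
      (diff φ y (B (0, y) (basisVec i)))) = 2 * firstVariation φ (IsSDiffCurve.velocity ψ) y := by
    intro y
    have h0 : A (0, y) = ContinuousLinearMap.id ℝ E3 := by
      rw [hA, IsSDiffCurve.pulledDeriv]
      exact h.spaceDeriv_zero _
    rw [firstVariation, Finset.mul_sum]
    have h1 : B (0, y) = fderiv ℝ (IsSDiffCurve.velocity ψ) y := h.fderiv_pulledDeriv_zero y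
    simp [h0, h1]
  simp only [hF'] at hkey
  obtain ⟨hi, hd⟩ := hkey
  refine ⟨?_, ?_⟩
  · simpa using hi.const_mul (1 / 2)
  · have h3 := hd.const_mul (1 / 2)
    rw [integral_const_mul] at h3
    simp only [dirichletEnergy_comp h hφ]
    rw [← mul_assoc] at h3
    norm_num at h3 ⊢
    exact h3

end

/-! ### The vector product and orthonormal frames -/

theorem inner_eq_sum (v w : E3) : inner ℝ v w = v 0 * w 0 + v 1 * w 1 + v 2 * w 2 := by
  simp [PiLp.inner_apply, Fin.sum_univ_three]
  ring

theorem cross_zero_apply (v w : E3) : cross v w 0 = v 1 * w 2 - v 2 * w 1 := by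
  simp [cross, crossProduct]

theorem cross_one_apply (v w : E3) : cross v w 1 = v 2 * w 0 - v 0 * w 2 := by
  simp [cross, crossProduct]

theorem cross_two_apply (v w : E3) : cross v w 2 = v 0 * w 1 - v 1 * w 0 := by
  simp [cross, crossProduct]

theorem ext_three {v w : E3} (h0 : v 0 = w 0) (h1 : v 1 = w 1) (h2 : v 2 = w 2) : v = w := by
  ext i
  fin_cases i <;> assumption

theorem inner_cross_left (v w : E3) : inner ℝ v (cross v w) = 0 := by
  rw [inner_eq_sum, cross_zero_apply, cross_one_apply, cross_two_apply]; ring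

theorem inner_cross_right (v w : E3) : inner ℝ w (cross v w) = 0 := by
  rw [inner_eq_sum, cross_zero_apply, cross_one_apply, cross_two_apply]; ring

theorem inner_cross_cross (v w z : E3) : inner ℝ (cross v w) (cross v z) =
    inner ℝ v v * inner ℝ w z - inner ℝ v w * inner ℝ v z := by
  simp only [inner_eq_sum, cross_zero_apply, cross_one_apply, cross_two_apply]; ring

theorem cross_add_right (v w z : E3) : cross v (w + z) = cross v w + cross v z := by
  refine ext_three ?_ ?_ ?_ <;> simp only [PiLp.add_apply, cross_zero_apply, cross_one_apply,
    cross_two_apply] <;> ring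

theorem cross_smul_right (c : ℝ) (v w : E3) : cross v (c • w) = c • cross v w := by
  refine ext_three ?_ ?_ ?_ <;> simp only [PiLp.smul_apply, cross_zero_apply, cross_one_apply,
    cross_two_apply, smul_eq_mul] <;> ring

theorem cross_self_eq_zero (v : E3) : cross v v = 0 := by
  refine ext_three ?_ ?_ ?_ <;> simp only [PiLp.zero_apply, cross_zero_apply, cross_one_apply,
    cross_two_apply] <;> ring

theorem exists_orthonormalBasis_cross {n : E3} (hn : ‖n‖ = 1) {e : E3} (he : ‖e‖ = 1)
    (hne : inner ℝ n e = 0) :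
    ∃ b : OrthonormalBasis (Fin 3) ℝ E3, b 0 = n ∧ b 1 = e ∧ b 2 = cross n e := by
  have hn2 : inner ℝ n n = 1 := by rw [real_inner_self_eq_norm_sq, hn, one_pow]
  have he2 : inner ℝ e e = 1 := by rw [real_inner_self_eq_norm_sq, he, one_pow]
  have hx : inner ℝ (cross n e) (cross n e) = (1 : ℝ) := by
    rw [inner_cross_cross, hn2, he2, hne]; norm_num
  have hv : Orthonormal ℝ ![n, e, cross n e] := by
    rw [orthonormal_iff_ite]
    intro i j
    have h1 := inner_cross_left n e
    have h2 := inner_cross_right n e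
    have h3 : inner ℝ e n = (0 : ℝ) := by rw [real_inner_comm, hne]
    have h4 : inner ℝ (cross n e) n = (0 : ℝ) := by rw [real_inner_comm, h1]
    have h5 : inner ℝ (cross n e) e = (0 : ℝ) := by rw [real_inner_comm, h2]
    have h6 : ‖cross n e‖ = 1 := by
      rw [real_inner_self_eq_norm_sq] at hx
      exact (pow_eq_one_iff_of_nonneg (norm_nonneg _) two_ne_zero).1 hx
    fin_cases i <;> fin_cases j <;> simp [hn, he, hne, h1, h2, h3, h4, h5, h6]
  refine ⟨(basisOfOrthonormalOfCardEqFinrank hv (by simp)).toOrthonormalBasis (by simpa using hv),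
    ?_, ?_, ?_⟩ <;> simp

theorem exists_unit_orthogonal (n : E3) : ∃ e : E3, ‖e‖ = 1 ∧ inner ℝ n e = 0 := by
  have h : ∃ v : E3, v ≠ 0 ∧ inner ℝ n v = 0 := by
    by_cases h0 : n 0 = 0 ∧ n 1 = 0
    · refine ⟨!₂[1, 0, 0], fun h => ?_, ?_⟩
      · simpa using congrArg (fun v : E3 => v 0) h
      · simp [inner_eq_sum, h0]
    · refine ⟨!₂[n 1, - n 0, 0], fun h => h0 ?_, ?_⟩
      · have h1 := congrArg (fun v : E3 => v 0) h
        have h2 := congrArg (fun v : E3 => v 1) h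
        simp at h1 h2
        exact ⟨h2, h1⟩
      · simp [inner_eq_sum]; ring
  obtain ⟨v, hv, hnv⟩ := h
  exact ⟨‖v‖⁻¹ • v, by simp [norm_smul, hv], by rw [inner_smul_right, hnv, mul_zero]⟩

/-! ### Maps that are constant on rays -/

theorem coe_direction {x : E3} (hx : x ≠ 0) : (direction x : E3) = ‖x‖⁻¹ • x := by
  simp [direction, hx]

theorem direction_smul {x : E3} (hx : x ≠ 0) {t : ℝ} (ht : 0 < t) :
    direction (t • x) = direction x := by
  apply Subtype.ext
  rw [coe_direction hx, coe_direction (smul_ne_zero ht.ne' hx), norm_smul, Real.norm_of_nonneg ht.le,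
    smul_smul]
  congr 1
  field_simp

theorem ne_zero_of_mem_sphere (n : S2) : (n : E3) ≠ 0 := ne_zero_of_mem_unit_sphere n

theorem norm_coe_S2 (n : S2) : ‖(n : E3)‖ = 1 := mem_sphere_zero_iff_norm.1 n.2

theorem direction_coe (n : S2) : direction (n : E3) = n := by
  apply Subtype.ext
  rw [coe_direction (ne_zero_of_mem_sphere n), norm_coe_S2, inv_one, one_smul]

theorem norm_rayExtension (R : S2 → S2) (x : E3) : ‖rayExtension R x‖ = 1 := norm_coe_S2 _

theorem rayExtension_smul (R : S2 → S2) {x : E3} (hx : x ≠ 0) {t : ℝ} (ht : 0 < t) :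
    rayExtension R (t • x) = rayExtension R x := by
  rw [rayExtension, rayExtension, direction_smul hx ht]

theorem rayExtension_coe (R : S2 → S2) (n : S2) : rayExtension R n = R n := by
  rw [rayExtension, direction_coe]

section

variable {R : S2 → S2} (hR : ContDiffOn ℝ ∞ (rayExtension R) {0}ᶜ)
include hR

theorem contDiffAt_rayExtension {x : E3} (hx : x ≠ 0) : ContDiffAt ℝ ∞ (rayExtension R) x :=
  (hR x hx).contDiffAt (isOpen_compl_singleton.mem_nhds hx)

theorem differentiableAt_rayExtension {x : E3} (hx : x ≠ 0) :
    DifferentiableAt ℝ (rayExtension R) x :=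
  (contDiffAt_rayExtension hR hx).differentiableAt (by simp)

theorem inner_rayExtension_fderiv {x : E3} (hx : x ≠ 0) (v : E3) :
    inner ℝ (rayExtension R x) (fderiv ℝ (rayExtension R) x v) = 0 := by
  have h1 := (differentiableAt_rayExtension hR hx).hasFDerivAt.norm_sq
  have h2 : (fun y => ‖rayExtension R y‖ ^ 2) = fun _ => (1 : ℝ) :=
    funext fun y => by rw [norm_rayExtension, one_pow]
  rw [h2] at h1
  have h3 := DFunLike.congr_fun (h1.unique (hasFDerivAt_const _ _)) v
  simpa using h3

theorem fderiv_rayExtension_self {x : E3} (hx : x ≠ 0) : fderiv ℝ (rayExtension R) x x = 0 := by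
  have h1 : HasDerivAt (fun t : ℝ => t • x) ((1 : ℝ) • x) 1 := (hasDerivAt_id 1).smul_const x
  have h2 : HasFDerivAt (rayExtension R) (fderiv ℝ (rayExtension R) x) ((1 : ℝ) • x) := by
    rw [one_smul]; exact (differentiableAt_rayExtension hR hx).hasFDerivAt
  have h3 := h2.comp_hasDerivAt (1 : ℝ) h1
  have h4 : (rayExtension R ∘ fun t : ℝ => t • x) =ᶠ[𝓝 1] fun _ => rayExtension R x := by
    filter_upwards [lt_mem_nhds (zero_lt_one (α := ℝ))] with t ht using rayExtension_smul R hx ht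
  have h5 := (h3.congr_of_eventuallyEq h4.symm).unique (hasDerivAt_const _ _)
  rwa [one_smul] at h5

theorem fderiv_rayExtension_eq {x : E3} (hx : x ≠ 0) (v : E3) :
    fderiv ℝ (rayExtension R) x v =
      ‖x‖⁻¹ • fderiv ℝ (rayExtension R) (direction x : E3) v := by
  have hr : 0 < ‖x‖⁻¹ := inv_pos.2 (norm_pos_iff.2 hx)
  have h1 : HasFDerivAt (fun y : E3 => ‖x‖⁻¹ • y) (‖x‖⁻¹ • ContinuousLinearMap.id ℝ E3) x :=
    (‖x‖⁻¹ • ContinuousLinearMap.id ℝ E3).hasFDerivAt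
  have h2 : HasFDerivAt (rayExtension R) (fderiv ℝ (rayExtension R) (‖x‖⁻¹ • x)) (‖x‖⁻¹ • x) :=
    (differentiableAt_rayExtension hR (smul_ne_zero hr.ne' hx)).hasFDerivAt
  have h3 := h2.comp x h1
  have h4 : rayExtension R =ᶠ[𝓝 x] (rayExtension R ∘ fun y : E3 => ‖x‖⁻¹ • y) := by
    filter_upwards [isOpen_compl_singleton.mem_nhds hx] with y hy
    exact (rayExtension_smul R hy hr).symm
  rw [(h3.congr_of_eventuallyEq h4).fderiv, coe_direction hx]
  simp

end

/-- The conformal factor of `R`, extended to be constant on rays. -/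
noncomputable def conformalFactor (R : S2 → S2) (x : E3) : ℝ :=
  (1 / 2) * ‖x‖ ^ 2 * ∑ i, ‖fderiv ℝ (rayExtension R) x (basisVec i)‖ ^ 2

theorem sum_inner_basisVec_sq (n : E3) : ∑ i, (inner ℝ n (basisVec i) : ℝ) ^ 2 = ‖n‖ ^ 2 := by
  rw [← real_inner_self_eq_norm_sq, inner_eq_sum, Fin.sum_univ_three]
  simp [basisVec, EuclideanSpace.inner_single_right]
  ring

/-- Take the frame `n, e, n × e`. The differential `L` kills `n`, and `L (n × e) = R(n) × L e` is
orthogonal to `L e` and of the same length, because `R(n)` is a unit vector orthogonal to `L e`. So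
the pulled back form is a multiple of the tangential part of the metric. -/
theorem IsHolomorphic.inner_fderiv_coe {R : S2 → S2} (hR : IsHolomorphic R) (n : S2) (v w : E3) :
    inner ℝ (fderiv ℝ (rayExtension R) n v) (fderiv ℝ (rayExtension R) n w) =
      conformalFactor R n * (inner ℝ v w - inner ℝ (n : E3) v * inner ℝ (n : E3) w) := by
  obtain ⟨e, he, hne⟩ := exists_unit_orthogonal n
  obtain ⟨b, hb0, hb1, hb2⟩ := exists_orthonormalBasis_cross (norm_coe_S2 n) he hne
  have hn0 := ne_zero_of_mem_sphere n
  set L := fderiv ℝ (rayExtension R) n with hL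
  have hLn : L n = 0 := fderiv_rayExtension_self hR.smooth hn0
  have hL2 : L (cross n e) = cross (R n) (L e) := hR.cauchyRiemann n e
  have hRe : inner ℝ (R n : E3) (L e) = 0 := by
    rw [← rayExtension_coe]
    exact inner_rayExtension_fderiv hR.smooth hn0 e
  have hRR : inner ℝ (R n : E3) (R n : E3) = (1 : ℝ) := by
    rw [real_inner_self_eq_norm_sq, norm_coe_S2, one_pow]
  set c : ℝ := inner ℝ (L e) (L e) with hc
  have h12 : inner ℝ (L e) (L (cross n e)) = (0 : ℝ) := by rw [hL2, inner_cross_right]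
  have h22 : inner ℝ (L (cross n e)) (L (cross n e)) = c := by
    rw [hL2, inner_cross_cross, hRR, hRe]; ring
  have hexp : ∀ v, L v = (inner ℝ e v : ℝ) • L e + (inner ℝ (cross n e) v : ℝ) • L (cross n e) := by
    intro v
    conv_lhs => rw [← b.sum_repr' v]
    simp [Fin.sum_univ_three, hb0, hb1, hb2, hLn]
  have hpar : ∀ v w : E3, (inner ℝ v w : ℝ) = inner ℝ (n : E3) v * inner ℝ (n : E3) w
      + inner ℝ e v * inner ℝ e w + inner ℝ (cross n e) v * inner ℝ (cross n e) w := by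
    intro v w
    rw [← b.sum_inner_mul_inner v w, Fin.sum_univ_three, hb0, hb1, hb2]
    simp only [real_inner_comm v]
  have key : ∀ v w, (inner ℝ (L v) (L w) : ℝ) =
      c * (inner ℝ v w - inner ℝ (n : E3) v * inner ℝ (n : E3) w) := by
    intro v w
    rw [hexp v, hexp w, hpar v w]
    simp only [inner_add_left, inner_add_right, inner_smul_left, inner_smul_right, h12, h22,
      real_inner_comm (L e) (L (cross n e)), ← hc]
    simp
    ring
  -- The projection onto the tangent plane has trace 2, which cancels the `1 / 2` in
  -- `conformalFactor`.
  have hcf : conformalFactor R n = c := by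
    have h1 : ∀ i, ‖L (basisVec i)‖ ^ 2 = c * (1 - (inner ℝ (n : E3) (basisVec i)) ^ 2) := by
      intro i
      rw [← real_inner_self_eq_norm_sq, key, real_inner_self_eq_norm_sq]
      simp [basisVec]
      left; ring
    rw [conformalFactor, norm_coe_S2]
    simp only [← hL, h1, ← Finset.mul_sum, Finset.sum_sub_distrib, sum_inner_basisVec_sq,
      norm_coe_S2]
    simp
    ring
  rw [key, hcf]

theorem conformalFactor_eq {R : S2 → S2} (hR : ContDiffOn ℝ ∞ (rayExtension R) {0}ᶜ) {x : E3}
    (hx : x ≠ 0) : conformalFactor R x = conformalFactor R (direction x : E3) := by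
  have hr : ‖x‖ ≠ 0 := norm_ne_zero_iff.2 hx
  simp only [conformalFactor, fderiv_rayExtension_eq hR hx, norm_smul, mul_pow, norm_coe_S2,
    ← Finset.mul_sum]
  simp
  field_simp

theorem IsHolomorphic.inner_fderiv {R : S2 → S2} (hR : IsHolomorphic R) {x : E3} (hx : x ≠ 0)
    (v w : E3) :
    inner ℝ (fderiv ℝ (rayExtension R) x v) (fderiv ℝ (rayExtension R) x w) =
      conformalFactor R x * (inner ℝ v w / ‖x‖ ^ 2 - inner ℝ x v * inner ℝ x w / ‖x‖ ^ 4) := by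
  have hr : ‖x‖ ≠ 0 := norm_ne_zero_iff.2 hx
  rw [fderiv_rayExtension_eq hR.smooth hx, fderiv_rayExtension_eq hR.smooth hx, inner_smul_left,
    inner_smul_right, hR.inner_fderiv_coe, conformalFactor_eq hR.smooth hx, coe_direction hx,
    inner_smul_left, inner_smul_left]
  simp
  field_simp

/-! ### The differential of a suspension -/

/-- The inclusion of `ℝ³` into `ℝ⁴` as the last three coordinates. -/
noncomputable def incl : E3 →L[ℝ] E4 := LinearMap.toContinuousLinearMap
  { toFun := fun v => !₂[0, v 0, v 1, v 2]
    map_add' := fun v w => by ext i; fin_cases i <;> simp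
    map_smul' := fun c v => by ext i; fin_cases i <;> simp }

theorem incl_apply (v : E3) : incl v = !₂[0, v 0, v 1, v 2] := rfl

theorem inner_incl_incl (v w : E3) : inner ℝ (incl v) (incl w) = (inner ℝ v w : ℝ) := by
  simp [incl_apply, PiLp.inner_apply, Fin.sum_univ_four, Fin.sum_univ_three]

theorem inner_vacuum_incl (v : E3) : inner ℝ (vacuum : E4) (incl v) = (0 : ℝ) := by
  simp [incl_apply, vacuum, PiLp.inner_apply]

theorem coe_polarPoint (α : ℝ) (n : S2) :
    (polarPoint α n : E4) = Real.cos α • (vacuum : E4) + Real.sin α • incl n := by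
  ext i
  fin_cases i <;> simp [polarPoint, vacuum, incl_apply]

theorem coe_suspension (f : ℝ → ℝ) (R : S2 → S2) (x : E3) :
    (suspension f R x : E4) =
      Real.cos (f ‖x‖) • (vacuum : E4) + Real.sin (f ‖x‖) • incl (rayExtension R x) :=
  coe_polarPoint _ _

theorem hasFDerivAt_norm {x : E3} (hx : x ≠ 0) :
    HasFDerivAt (fun y : E3 => ‖y‖) (‖x‖⁻¹ • innerSL ℝ x) x := by
  have h1 := ((hasStrictFDerivAt_norm_sq x).hasFDerivAt).sqrt
    (pow_ne_zero 2 (norm_ne_zero_iff.2 hx))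
  have h2 : (fun y : E3 => Real.sqrt (‖y‖ ^ 2)) = fun y => ‖y‖ :=
    funext fun y => Real.sqrt_sq (norm_nonneg y)
  rw [h2, Real.sqrt_sq (norm_nonneg x)] at h1
  refine h1.congr_fderiv ?_
  ext v
  have hr : ‖x‖ ≠ 0 := norm_ne_zero_iff.2 hx
  simp
  field_simp

theorem diff_suspension {f : ℝ → ℝ} {R : S2 → S2} {x : E3} (hx : x ≠ 0)
    (hf : DifferentiableAt ℝ f ‖x‖) (hR : DifferentiableAt ℝ (rayExtension R) x) (v : E3) :
    diff (suspension f R) x v =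
      (-(Real.sin (f ‖x‖) * (deriv f ‖x‖ * (inner ℝ x v / ‖x‖)))) • (vacuum : E4) +
      ((Real.cos (f ‖x‖) * (deriv f ‖x‖ * (inner ℝ x v / ‖x‖))) • incl (rayExtension R x) +
        Real.sin (f ‖x‖) • incl (fderiv ℝ (rayExtension R) x v)) := by
  have h1 : HasFDerivAt (fun y : E3 => f ‖y‖) (deriv f ‖x‖ • (‖x‖⁻¹ • innerSL ℝ x)) x :=
    hf.hasDerivAt.comp_hasFDerivAt x (hasFDerivAt_norm hx)
  have h2 : HasFDerivAt (fun y => incl (rayExtension R y)) _ x :=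
    incl.hasFDerivAt.comp x hR.hasFDerivAt
  have h3 := (h1.cos.smul_const (vacuum : E4)).add (h1.sin.smul h2)
  have h4 : diff (suspension f R) x = _ := (h3.congr_of_eventuallyEq
    (Eventually.of_forall fun y => coe_suspension f R y)).fderiv
  rw [h4]
  simp only [add_apply, ContinuousLinearMap.smulRight_apply, smul_apply,
    innerSL_apply_apply, ContinuousLinearMap.comp_apply, smul_eq_mul]
  congr 1
  · congr 1; ring
  · rw [add_comm]; congr 2; ring

/-- In `diff_suspension` the vacuum direction, `R` and the image of `dR` are mutually orthogonal.
The first two contributions combine through `sin² + cos² = 1` to the radial term in `f'²`; the third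
is conformal on the tangent planes of spheres. -/
theorem inner_diff_suspension {f : ℝ → ℝ} {R : S2 → S2} (hR : IsHolomorphic R) {x : E3}
    (hx : x ≠ 0) (hf : DifferentiableAt ℝ f ‖x‖) (v w : E3) :
    inner ℝ (diff (suspension f R) x v) (diff (suspension f R) x w) =
      Real.sin (f ‖x‖) ^ 2 * conformalFactor R x / ‖x‖ ^ 2 * inner ℝ v w +
      (deriv f ‖x‖ ^ 2 / ‖x‖ ^ 2 - Real.sin (f ‖x‖) ^ 2 * conformalFactor R x / ‖x‖ ^ 4) *
        (inner ℝ x v * inner ℝ x w) := by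
  have hr : ‖x‖ ≠ 0 := norm_ne_zero_iff.2 hx
  have hRx := differentiableAt_rayExtension hR.smooth hx
  have h1 : ∀ v, inner ℝ (fderiv ℝ (rayExtension R) x v) (rayExtension R x) = (0 : ℝ) := fun v => by
    rw [real_inner_comm]; exact inner_rayExtension_fderiv hR.smooth hx v
  have h2 : ∀ v, inner ℝ (incl v) (vacuum : E4) = (0 : ℝ) := fun v => by
    rw [real_inner_comm]; exact inner_vacuum_incl v
  have h3 : inner ℝ (vacuum : E4) (vacuum : E4) = (1 : ℝ) := by
    rw [real_inner_self_eq_norm_sq, mem_sphere_zero_iff_norm.1 vacuum.2, one_pow]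
  have h4 : inner ℝ (rayExtension R x) (rayExtension R x) = (1 : ℝ) := by
    rw [real_inner_self_eq_norm_sq, norm_rayExtension, one_pow]
  rw [diff_suspension hx hf hRx, diff_suspension hx hf hRx]
  simp only [inner_add_left, inner_add_right, inner_smul_left, inner_smul_right, inner_incl_incl,
    inner_vacuum_incl, h1, h2, h3, h4, inner_rayExtension_fderiv hR.smooth hx,
    hR.inner_fderiv hx, conj_trivial]
  have h5 := Real.sin_sq_add_cos_sq (f ‖x‖)
  field_simp
  linear_combination (deriv f ‖x‖ ^ 2 * inner ℝ x v * inner ℝ x w * ‖x‖ ^ 2) * h5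

theorem energyDensity_suspension {f : ℝ → ℝ} {R : S2 → S2} (hR : IsHolomorphic R) {x : E3}
    (hx : x ≠ 0) (hf : DifferentiableAt ℝ f ‖x‖) :
    energyDensity (suspension f R) x =
      deriv f ‖x‖ ^ 2 + 2 * Real.sin (f ‖x‖) ^ 2 * conformalFactor R x / ‖x‖ ^ 2 := by
  have hr : ‖x‖ ≠ 0 := norm_ne_zero_iff.2 hx
  have h1 : ∀ i, ‖partialD (suspension f R) i x‖ ^ 2 =
      Real.sin (f ‖x‖) ^ 2 * conformalFactor R x / ‖x‖ ^ 2 +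
      (deriv f ‖x‖ ^ 2 / ‖x‖ ^ 2 - Real.sin (f ‖x‖) ^ 2 * conformalFactor R x / ‖x‖ ^ 4) *
        (inner ℝ x (basisVec i)) ^ 2 := fun i => by
    rw [← real_inner_self_eq_norm_sq]
    refine (inner_diff_suspension hR hx hf (basisVec i) (basisVec i)).trans ?_
    rw [real_inner_self_eq_norm_sq]
    simp [basisVec]
    ring_nf
    simp
  simp only [energyDensity, h1, Finset.sum_add_distrib, ← Finset.mul_sum, sum_inner_basisVec_sq]
  simp
  field_simp
  ring

/-- The `μ` term contributes `μ div X = 0`. For the other one, differentiating `u = ⟨x, X⟩` in the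
direction `x` gives `⟨x, DX x⟩ = E u - u` with `E = x · ∇`. -/
theorem firstVariation_eq {φ : E3 → S3} {X : E3 → E3} {x : E3} {μ β : ℝ}
    (hφ : ∀ v w, inner ℝ (diff φ x v) (diff φ x w) =
      μ * inner ℝ v w + β * (inner ℝ x v * inner ℝ x w))
    (hX : DifferentiableAt ℝ X x) (hdiv : divergence X x = 0) :
    firstVariation φ X x = β * (fderiv ℝ (radialPart X) x x - radialPart X x) := by
  have h1 : fderiv ℝ (radialPart X) x x = radialPart X x + inner ℝ x (fderiv ℝ X x x) := by
    have h2 : HasFDerivAt (radialPart X) _ x := (hasFDerivAt_id x).inner ℝ hX.hasFDerivAt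
    rw [h2.fderiv]
    simp [radialPart, add_comm]
  have h3 : fderiv ℝ X x x = ∑ i, x i • fderiv ℝ X x (basisVec i) := by
    simpa using congrArg (fderiv ℝ X x) (sum_basisVec x).symm
  have hb : ∀ (v : E3) i, (inner ℝ (basisVec i) v : ℝ) = v i := fun v i => by
    simp [basisVec, EuclideanSpace.inner_single_left]
  have hb' : ∀ (v : E3) i, (inner ℝ v (basisVec i) : ℝ) = v i := fun v i => by
    rw [real_inner_comm, hb]
  rw [h1, h3, inner_sum]
  simp only [firstVariation, hφ, hb, hb', Finset.sum_add_distrib, ← Finset.mul_sum,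
    inner_smul_right]
  rw [divergence] at hdiv
  rw [hdiv]
  ring

/-! ### The identity of `S²` -/

theorem rayExtension_id {x : E3} (hx : x ≠ 0) : rayExtension id x = ‖x‖⁻¹ • x := coe_direction hx

theorem contDiffOn_rayExtension_id : ContDiffOn ℝ ∞ (rayExtension id) {0}ᶜ := by
  refine ContDiffOn.congr (f := fun x => ‖x‖⁻¹ • x) (fun x hx => ?_) fun x hx => rayExtension_id hx
  exact (((contDiffAt_norm ℝ hx).inv (norm_ne_zero_iff.2 hx)).smul contDiffAt_id).contDiffWithinAt

theorem fderiv_rayExtension_id_coe (n : S2) (v : E3) :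
    fderiv ℝ (rayExtension id) (n : E3) v = v - inner ℝ (n : E3) v • (n : E3) := by
  have hn := ne_zero_of_mem_sphere n
  have h1 := ((hasDerivAt_inv (norm_ne_zero_iff.2 hn)).comp_hasFDerivAt (n : E3)
    (hasFDerivAt_norm hn)).smul (hasFDerivAt_id (n : E3))
  have h2 : rayExtension id =ᶠ[𝓝 (n : E3)] fun x => ‖x‖⁻¹ • id x := by
    filter_upwards [isOpen_compl_singleton.mem_nhds hn] with y hy using rayExtension_id hy
  rw [(h1.congr_of_eventuallyEq h2).fderiv]
  simp [sub_eq_add_neg]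

theorem isHolomorphic_id : IsHolomorphic id where
  smooth := contDiffOn_rayExtension_id
  cauchyRiemann n v := by
    rw [fderiv_rayExtension_id_coe, fderiv_rayExtension_id_coe, inner_cross_left, zero_smul,
      sub_zero, sub_eq_add_neg, cross_add_right, ← neg_smul, cross_smul_right, id,
      cross_self_eq_zero, smul_zero, add_zero]

theorem conformalFactor_id {x : E3} (hx : x ≠ 0) : conformalFactor id x = 1 := by
  rw [conformalFactor_eq contDiffOn_rayExtension_id hx]
  set n := direction x
  have h1 : ∀ i, ‖fderiv ℝ (rayExtension id) (n : E3) (basisVec i)‖ ^ 2 =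
      1 - (inner ℝ (n : E3) (basisVec i)) ^ 2 := fun i => by
    rw [fderiv_rayExtension_id_coe, norm_sub_sq_real, norm_smul, inner_smul_right, norm_coe_S2,
      real_inner_comm (n : E3)]
    simp [basisVec]
    ring
  simp only [conformalFactor, h1, Finset.sum_sub_distrib, sum_inner_basisVec_sq, norm_coe_S2]
  norm_num

/-! ### Profile functions -/

namespace IsProfile

variable {k : ℤ} {f : ℝ → ℝ} (hf : IsProfile k f)
include hf

theorem contDiffAt {r : ℝ} (hr : 0 < r) : ContDiffAt ℝ ∞ f r :=
  hf.smooth.contDiffAt (Ici_mem_nhds hr)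

theorem differentiableAt {r : ℝ} (hr : 0 < r) : DifferentiableAt ℝ f r :=
  (hf.contDiffAt hr).differentiableAt (by simp)

theorem continuous_abs : Continuous fun r => f |r| :=
  hf.smooth.continuousOn.comp_continuous _root_.continuous_abs abs_nonneg

theorem continuous_norm : Continuous fun x : E3 => f ‖x‖ :=
  hf.smooth.continuousOn.comp_continuous _root_.continuous_norm norm_nonneg

theorem sin_zero : Real.sin (f 0) = 0 := by rw [hf.zero, Real.sin_int_mul_pi]

theorem smoothOn_suspension {R : S2 → S2} (hR : ContDiffOn ℝ ∞ (rayExtension R) {0}ᶜ) :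
    SmoothOn {0}ᶜ (suspension f R) := by
  intro x hx
  have h1 : ContDiffAt ℝ ∞ (fun y : E3 => f ‖y‖) x :=
    (hf.contDiffAt (norm_pos_iff.2 hx)).comp x (contDiffAt_norm ℝ hx)
  have h2 : ContDiffAt ℝ ∞ (fun y => incl (rayExtension R y)) x :=
    incl.contDiff.contDiffAt.comp x (contDiffAt_rayExtension hR hx)
  exact ((h1.cos.smul contDiffAt_const).add (h1.sin.smul h2)).congr_of_eventuallyEq
    (Eventually.of_forall fun y => coe_suspension f R y) |>.contDiffWithinAt

end IsProfile

/-- The direction of `x` has no limit at the origin or at infinity, but it enters only through a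
unit vector multiplied by `sin f`, which tends to zero. -/
theorem tendsto_suspension {f : ℝ → ℝ} (R : S2 → S2) {l : Filter E3} {c : ℝ}
    (hc : Tendsto (fun x => Real.cos (f ‖x‖)) l (𝓝 c))
    (hs : Tendsto (fun x => Real.sin (f ‖x‖)) l (𝓝 0)) :
    Tendsto (fun x => (suspension f R x : E4)) l (𝓝 (c • (vacuum : E4))) := by
  simp only [coe_suspension]
  have h1 : Tendsto (fun x => Real.sin (f ‖x‖) • incl (rayExtension R x)) l (𝓝 0) := by
    rw [tendsto_zero_iff_norm_tendsto_zero]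
    have h2 : ∀ x, ‖Real.sin (f ‖x‖) • incl (rayExtension R x)‖ = ‖Real.sin (f ‖x‖)‖ := fun x => by
      have h3 : ‖incl (rayExtension R x)‖ = 1 := by
        rw [← sq_eq_sq₀ (norm_nonneg _) zero_le_one, ← real_inner_self_eq_norm_sq,
          inner_incl_incl, real_inner_self_eq_norm_sq, norm_rayExtension]
      rw [norm_smul, h3, mul_one]
    simp only [h2]
    simpa using hs.norm
  simpa using (hc.smul_const (vacuum : E4)).add h1

theorem IsProfile.isSkyrmeField {k : ℤ} {f : ℝ → ℝ} (hf : IsProfile k f) {R : S2 → S2}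
    (hR : ContDiffOn ℝ ∞ (rayExtension R) {0}ᶜ) : IsSkyrmeField (suspension f R) where
  continuous := by
    rw [continuous_induced_rng, continuous_iff_continuousAt]
    intro x
    by_cases hx : x = 0
    · subst hx
      have h1 := tendsto_suspension (f := f) R (l := 𝓝 0)
        (Real.continuous_cos.comp hf.continuous_norm).continuousAt
        (by simpa [hf.sin_zero, Function.comp_def] using
          (Real.continuous_sin.comp hf.continuous_norm).tendsto 0)
      have h2 : (suspension f R 0 : E4) = Real.cos (f ‖(0 : E3)‖) • (vacuum : E4) := by
        rw [coe_suspension, norm_zero, hf.sin_zero, zero_smul, add_zero]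
      rw [ContinuousAt, Function.comp_apply, h2]
      exact h1
    · exact (hf.smoothOn_suspension hR x hx).contDiffAt
        (isOpen_compl_singleton.mem_nhds hx) |>.continuousAt
  boundary := by
    rw [tendsto_subtype_rng]
    have h1 : Tendsto (fun x : E3 => f ‖x‖) (cocompact E3) (𝓝 0) :=
      hf.infty.comp tendsto_norm_cocompact_atTop
    have h2 := tendsto_suspension (f := f) R (l := cocompact E3) (c := 1)
      (by simpa [Function.comp_def] using (Real.continuous_cos.tendsto 0).comp h1)
      (by simpa [Function.comp_def] using (Real.continuous_sin.tendsto 0).comp h1)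
    simpa using h2

/-! ### Hedgehogs are restricted harmonic -/

/-- The conformal factor of the identity is 1, so the coefficient `β` is radial. It may be singular
at the origin, hence the use of the version for measurable radial coefficients. -/
theorem IsProfile.integral_firstVariation_eq_zero {k : ℤ} {f : ℝ → ℝ} (hf : IsProfile k f)
    {X : E3 → E3} (hX : ContDiff ℝ ∞ X) (hc : HasCompactSupport X)
    (hdiv : ∀ x, divergence X x = 0) (hi : Integrable (firstVariation (hedgehog f) X)) :
    ∫ x, firstVariation (hedgehog f) X x = 0 := by
  -- A profile is controlled only on `[0, ∞)`; `|r|` makes the function measurable on all of `ℝ`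
  -- without changing it at `r = ‖x‖`.
  set b : ℝ → ℝ := fun r => deriv f r ^ 2 / r ^ 2 - Real.sin (f |r|) ^ 2 / r ^ 4 with hb
  have hbm : Measurable b := by
    have h1 : Measurable fun r => f |r| := hf.continuous_abs.measurable
    have h2 : Measurable (deriv f) := measurable_deriv f
    have h3 : Measurable fun r => Real.sin (f |r|) := Real.measurable_sin.comp h1
    fun_prop
  have heq : firstVariation (hedgehog f) X =ᵐ[volume]
      fun x => b ‖x‖ * (fderiv ℝ (radialPart X) x x - radialPart X x) := by
    filter_upwards [ae_ne_zero] with x hx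
    refine firstVariation_eq (fun v w => ?_) (hX.differentiable (by simp) x) (hdiv x)
      (μ := Real.sin (f ‖x‖) ^ 2 / ‖x‖ ^ 2)
    rw [hedgehog, inner_diff_suspension isHolomorphic_id hx
      (hf.differentiableAt (norm_pos_iff.2 hx)), conformalFactor_id hx]
    simp [hb]
  rw [integral_congr_ae heq]
  exact integral_radial_mul_euler_radialPart_eq_zero hX hc hdiv hbm (hi.congr heq)

theorem dirichletEnergy_compl_zero (φ : E3 → S3) :
    dirichletEnergy {0}ᶜ φ = dirichletEnergy univ φ := by
  rw [dirichletEnergy, dirichletEnergy, setIntegral_compl_zero, Measure.restrict_univ]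

/-- The origin is a null set and the domain `U` of the curve is arbitrary, so this one statement
serves both the punctured and the full space. -/
theorem IsProfile.hasDerivAt_dirichletEnergy {k : ℤ} {f : ℝ → ℝ} (hf : IsProfile k f)
    (hfin : FiniteEnergy {0}ᶜ (hedgehog f)) {U : Set E3} {ψ : ℝ → (E3 ≃ₘ[ℝ] E3)}
    (h : IsSDiffCurve U ψ) :
    HasDerivAt (fun t => dirichletEnergy univ (hedgehog f ∘ ψ t)) 0 0 := by
  obtain ⟨h1, h2⟩ := hasDerivAt_dirichletEnergy_comp h
    (φ := hedgehog f) (hf.smoothOn_suspension contDiffOn_rayExtension_id) (integrableOn_compl_zero.1 hfin)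
  rwa [hf.integral_firstVariation_eq_zero h.contDiff_velocity h.hasCompactSupport_velocity
    h.divergence_velocity h1] at h2

theorem IsProfile.restrictedHarmonic_hedgehog_compl_zero {k : ℤ} {f : ℝ → ℝ} (hf : IsProfile k f)
    (hfin : FiniteEnergy {0}ᶜ (hedgehog f)) : RestrictedHarmonic {0}ᶜ (hedgehog f) where
  smooth := hf.smoothOn_suspension contDiffOn_rayExtension_id
  finite := hfin
  critical ψ hψ := by
    simp only [dirichletEnergy_compl_zero]
    exact hf.hasDerivAt_dirichletEnergy hfin hψ

theorem IsProfile.restrictedHarmonic_hedgehog {k : ℤ} {f : ℝ → ℝ} (hf : IsProfile k f)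
    (hfin : FiniteEnergy {0}ᶜ (hedgehog f)) (hs : SmoothOn univ (hedgehog f)) :
    RestrictedHarmonic univ (hedgehog f) where
  smooth := hs
  finite := integrableOn_univ.2 (integrableOn_compl_zero.1 hfin)
  critical _ hψ := hf.hasDerivAt_dirichletEnergy hfin hψ

/-! ### The degree of a hedgehog -/

/-- The rows are the three partial derivatives of the hedgehog at `r n` and its value there, with `C
= cos f`, `S = sin f`, `D = f'` and `q = sin f / r`. -/
theorem det_hedgehog_rows (C S D q n₀ n₁ n₂ : ℝ) (hn : n₀ ^ 2 + n₁ ^ 2 + n₂ ^ 2 = 1)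
    (hCS : S ^ 2 + C ^ 2 = 1) :
    Matrix.det !![-(S * D * n₀), C * D * n₀ * n₀ + q * (1 - n₀ * n₀),
        C * D * n₀ * n₁ + q * (0 - n₀ * n₁), C * D * n₀ * n₂ + q * (0 - n₀ * n₂);
      -(S * D * n₁), C * D * n₁ * n₀ + q * (0 - n₁ * n₀),
        C * D * n₁ * n₁ + q * (1 - n₁ * n₁), C * D * n₁ * n₂ + q * (0 - n₁ * n₂);
      -(S * D * n₂), C * D * n₂ * n₀ + q * (0 - n₂ * n₀),
        C * D * n₂ * n₁ + q * (0 - n₂ * n₁), C * D * n₂ * n₂ + q * (1 - n₂ * n₂);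
      C, S * n₀, S * n₁, S * n₂] = -(D * q ^ 2) := by
  simp [Matrix.det_succ_row_zero, Fin.sum_univ_succ, Fin.succAbove]
  linear_combination (C * q ^ 3 - q ^ 2 * D) * hn -
    q ^ 2 * D * (n₀ ^ 2 + n₁ ^ 2 + n₂ ^ 2) * hCS

theorem coe_vacuum : (vacuum : E4) = !₂[1, 0, 0, 0] := by
  ext i
  fin_cases i <;> simp [vacuum]

theorem degreeDensity_hedgehog {f : ℝ → ℝ} {x : E3} (hx : x ≠ 0)
    (hf : DifferentiableAt ℝ f ‖x‖) :
    degreeDensity (hedgehog f) x = -(deriv f ‖x‖ * (Real.sin (f ‖x‖) / ‖x‖) ^ 2) := by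
  set n := direction x with hn
  have hnx : x = ‖x‖ • (n : E3) := by
    rw [hn, coe_direction hx, smul_smul, mul_inv_cancel₀ (norm_ne_zero_iff.2 hx), one_smul]
  have hr : ‖x‖ ≠ 0 := norm_ne_zero_iff.2 hx
  have hn1 : (n : E3) 0 ^ 2 + (n : E3) 1 ^ 2 + (n : E3) 2 ^ 2 = 1 := by
    have h1 := inner_eq_sum (n : E3) n
    rw [real_inner_self_eq_norm_sq, norm_coe_S2] at h1
    linarith
  have hinner : ∀ i, inner ℝ x (basisVec i) / ‖x‖ = (n : E3) i := fun i => by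
    rw [hnx, inner_smul_left, norm_smul, norm_coe_S2]
    simp [basisVec, EuclideanSpace.inner_single_right]
    field_simp
  have hinner' : ∀ i, inner ℝ (n : E3) (basisVec i) = (n : E3) i := fun i => by
    simp [basisVec, EuclideanSpace.inner_single_right]
  have hpart : ∀ i, partialD (hedgehog f) i x =
      (-(Real.sin (f ‖x‖) * (deriv f ‖x‖ * (n : E3) i))) • (vacuum : E4) +
      ((Real.cos (f ‖x‖) * (deriv f ‖x‖ * (n : E3) i)) • incl n +
        Real.sin (f ‖x‖) • incl (‖x‖⁻¹ • (basisVec i - (n : E3) i • (n : E3)))) := fun i => by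
    have h1 := diff_suspension hx hf
      (differentiableAt_rayExtension contDiffOn_rayExtension_id hx) (basisVec i)
    rw [hinner, fderiv_rayExtension_eq contDiffOn_rayExtension_id hx, fderiv_rayExtension_id_coe,
      hinner'] at h1
    exact h1
  rw [← det_hedgehog_rows _ _ _ _ _ _ _ hn1 (Real.sin_sq_add_cos_sq (f ‖x‖)), degreeDensity]
  congr 1
  ext i j
  have hφ : (hedgehog f x : E4) = Real.cos (f ‖x‖) • (vacuum : E4) + Real.sin (f ‖x‖) • incl n :=
    coe_suspension f id x
  fin_cases i <;> fin_cases j <;>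
    simp [hpart, hφ, coe_vacuum, incl_apply, basisVec] <;> ring

/-- On `(0, 1]` the integrand is bounded, as `f` is smooth up to the boundary. For `r > 1`, `|f'
sin² f| ≤ |f'| |sin f|` is dominated by `r² f'² + 2 sin² f`, the radial energy integrand. -/
theorem IsProfile.integrableOn_deriv_mul_sin_sq {k : ℤ} {f : ℝ → ℝ} (hf : IsProfile k f)
    (hfin : FiniteEnergy {0}ᶜ (hedgehog f)) :
    IntegrableOn (fun r => -(deriv f r * Real.sin (f r) ^ 2)) (Ioi 0) := by
  have hmeas : AEStronglyMeasurable (fun r => -(deriv f r * Real.sin (f r) ^ 2))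
      (volume.restrict (Ioi 0)) := by
    have h1 : Measurable fun r => f |r| := hf.continuous_abs.measurable
    have h2 : Measurable (deriv f) := measurable_deriv f
    have h3 : Measurable fun r => -(deriv f r * Real.sin (f |r|) ^ 2) :=
      (h2.mul ((Real.measurable_sin.comp h1).pow_const 2)).neg
    refine h3.aestronglyMeasurable.congr ?_
    filter_upwards [ae_restrict_mem measurableSet_Ioi] with r hr
    rw [abs_of_pos hr]
  have he : Integrable fun x : E3 =>
      (fun r => deriv f r ^ 2 + 2 * Real.sin (f r) ^ 2 / r ^ 2) ‖x‖ := by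
    refine (integrableOn_compl_zero.1 hfin).congr ?_
    filter_upwards [ae_ne_zero] with x hx
    rw [hedgehog, energyDensity_suspension isHolomorphic_id hx
      (hf.differentiableAt (norm_pos_iff.2 hx)), conformalFactor_id hx, mul_one]
  rw [integrable_fun_norm_addHaar volume
    (f := fun r => deriv f r ^ 2 + 2 * Real.sin (f r) ^ 2 / r ^ 2)] at he
  rw [← Ioc_union_Ioi_eq_Ioi zero_le_one, integrableOn_union]
  constructor
  -- The one-sided derivative is continuous up to `0`, whereas `deriv f 0` depends on the
  -- uncontrolled values of `f` at negative arguments.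
  · have hd : ContinuousOn (derivWithin f (Ici 0)) (Icc 0 1) :=
      (hf.smooth.continuousOn_derivWithin (uniqueDiffOn_Ici 0) (by simp)).mono Icc_subset_Ici_self
    have hc : ContinuousOn (fun r => -(derivWithin f (Ici 0) r * Real.sin (f r) ^ 2)) (Icc 0 1) :=
      (hd.mul ((Real.continuous_sin.comp_continuousOn
        (hf.smooth.continuousOn.mono Icc_subset_Ici_self)).pow 2)).neg
    refine (hc.integrableOn_Icc.mono_set Ioc_subset_Icc_self).congr_fun (fun r hr => ?_)
      measurableSet_Ioc
    dsimp only
    rw [derivWithin_of_mem_nhds (Ici_mem_nhds hr.1)]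
  · refine Integrable.mono (he.mono_set (Ioi_subset_Ioi zero_le_one))
      (hmeas.mono_set (Ioi_subset_Ioi zero_le_one)) ?_
    filter_upwards [ae_restrict_mem measurableSet_Ioi] with r hr
    have hr1 : (1 : ℝ) < r := hr
    have hr0 : r ≠ 0 := by positivity
    have hs1 := Real.abs_sin_le_one (f r)
    have h1 : r ^ 2 * (deriv f r ^ 2 + 2 * Real.sin (f r) ^ 2 / r ^ 2) =
        r ^ 2 * deriv f r ^ 2 + 2 * Real.sin (f r) ^ 2 := by field_simp
    simp only [finrank_euclideanSpace_fin, smul_eq_mul]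
    norm_num
    rw [abs_of_nonneg (a := deriv f r ^ 2 + _) (by positivity), h1]
    have h2 : |deriv f r| * Real.sin (f r) ^ 2 ≤ |deriv f r| * |Real.sin (f r)| := by
      refine mul_le_mul_of_nonneg_left ?_ (abs_nonneg _)
      rw [← sq_abs]
      nlinarith [abs_nonneg (Real.sin (f r))]
    have h3 : deriv f r ^ 2 ≤ r ^ 2 * deriv f r ^ 2 :=
      le_mul_of_one_le_left (sq_nonneg _) (by nlinarith)
    nlinarith [sq_nonneg (|deriv f r| - |Real.sin (f r)|), sq_abs (deriv f r),
      sq_abs (Real.sin (f r))]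

/-- The integrand is the derivative of `-(f / 2 - sin (2 f) / 4)`, which equals `-kπ / 2` at `0` and
tends to `0` at infinity. -/
theorem IsProfile.integral_deriv_mul_sin_sq {k : ℤ} {f : ℝ → ℝ} (hf : IsProfile k f)
    (hfin : FiniteEnergy {0}ᶜ (hedgehog f)) :
    ∫ r in Ioi (0 : ℝ), -(deriv f r * Real.sin (f r) ^ 2) = k * Real.pi / 2 := by
  have hcont : ContinuousWithinAt (fun r => -(f r / 2 - Real.sin (2 * f r) / 4)) (Ici 0) 0 := by
    have h1 : ContinuousWithinAt f (Ici 0) 0 := hf.smooth.continuousOn 0 self_mem_Ici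
    have h2 : Continuous fun s : ℝ => -(s / 2 - Real.sin (2 * s) / 4) := by fun_prop
    exact h2.continuousAt.comp_continuousWithinAt h1
  have hder : ∀ r ∈ Ioi (0 : ℝ), HasDerivAt (fun r => -(f r / 2 - Real.sin (2 * f r) / 4))
      (-(deriv f r * Real.sin (f r) ^ 2)) r := by
    intro r hr
    have h1 := (hf.differentiableAt hr).hasDerivAt
    refine ((h1.div_const 2).sub ((h1.const_mul 2).sin.div_const 4)).neg.congr_deriv ?_
    rw [Real.cos_two_mul, Real.cos_sq']
    ring
  have hlim : Tendsto (fun r => -(f r / 2 - Real.sin (2 * f r) / 4)) atTop (𝓝 0) := by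
    have h2 : Continuous fun s : ℝ => -(s / 2 - Real.sin (2 * s) / 4) := by fun_prop
    simpa [Function.comp_def] using (h2.tendsto 0).comp hf.infty
  rw [integral_Ioi_of_hasDerivAt_of_tendsto hcont hder (hf.integrableOn_deriv_mul_sin_sq hfin) hlim,
    hf.zero]
  have h3 : Real.sin (2 * (k * Real.pi)) = 0 := by
    have := Real.sin_int_mul_pi (2 * k)
    push_cast at this
    rwa [mul_assoc] at this
  rw [h3]
  ring

/-- In polar coordinates the integral is `4π · kπ / 2`, where `4π` arises as three times the volume
of the unit ball. -/
theorem IsProfile.hasDegree_hedgehog {k : ℤ} {f : ℝ → ℝ} (hf : IsProfile k f)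
    (hfin : FiniteEnergy {0}ᶜ (hedgehog f)) : HasDegree (hedgehog f) k := by
  set g : ℝ → ℝ := fun r => -(deriv f r * (Real.sin (f r) / r) ^ 2) with hg
  have heq : degreeDensity (hedgehog f) =ᵐ[volume] fun x => g ‖x‖ := by
    filter_upwards [ae_ne_zero] with x hx
    exact degreeDensity_hedgehog hx (hf.differentiableAt (norm_pos_iff.2 hx))
  have hg2 : ∀ r ∈ Ioi (0 : ℝ), r ^ 2 * g r = -(deriv f r * Real.sin (f r) ^ 2) := by
    intro r hr
    have hr0 : r ≠ 0 := ne_of_gt hr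
    simp only [hg]
    field_simp
  constructor
  · rw [integrable_congr heq, integrable_fun_norm_addHaar volume (f := g)]
    refine (hf.integrableOn_deriv_mul_sin_sq hfin).congr_fun (fun r hr => ?_) measurableSet_Ioi
    simpa using (hg2 r hr).symm
  · rw [integral_congr_ae heq, integral_fun_norm_addHaar volume g]
    have h1 : ∫ r in Ioi (0 : ℝ), r ^ (Module.finrank ℝ E3 - 1) • g r = k * Real.pi / 2 := by
      rw [← hf.integral_deriv_mul_sin_sq hfin]
      refine setIntegral_congr_fun measurableSet_Ioi fun r hr => ?_
      simpa using hg2 r hr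
    rw [h1]
    simp only [measureReal_def, EuclideanSpace.volume_ball_fin_three, finrank_euclideanSpace_fin,
      ENNReal.ofReal_one, one_pow, one_mul, nsmul_eq_mul, smul_eq_mul]
    rw [ENNReal.toReal_ofReal (by positivity)]
    push_cast
    ring

/-! ### Smooth hedgehogs of every degree -/

/-- A monotone profile that is constant near the origin and vanishes outside a ball. -/
noncomputable def transitionProfile (k : ℤ) (r : ℝ) : ℝ :=
  k * Real.pi * (1 - Real.smoothTransition (r - 1))

theorem contDiff_transitionProfile (k : ℤ) : ContDiff ℝ ∞ (transitionProfile k) :=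
  contDiff_const.mul (contDiff_const.sub
    (Real.smoothTransition.contDiff.comp (contDiff_id.sub contDiff_const)))

theorem transitionProfile_of_le (k : ℤ) {r : ℝ} (hr : r ≤ 1) :
    transitionProfile k r = k * Real.pi := by
  rw [transitionProfile, Real.smoothTransition.zero_of_nonpos (by linarith)]; ring

theorem transitionProfile_of_ge (k : ℤ) {r : ℝ} (hr : 2 ≤ r) : transitionProfile k r = 0 := by
  rw [transitionProfile, Real.smoothTransition.one_of_one_le (by linarith)]; ring

theorem isProfile_transitionProfile (k : ℤ) : IsProfile k (transitionProfile k) where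
  smooth := (contDiff_transitionProfile k).contDiffOn
  zero := transitionProfile_of_le k zero_le_one
  infty := tendsto_const_nhds.congr' <| by
    filter_upwards [eventually_ge_atTop 2] with r hr using (transitionProfile_of_ge k hr).symm

/-- On the unit ball the profile is `kπ`, so `sin f = 0` there and the field is constant; the
singular direction vector never enters. -/
theorem smoothOn_hedgehog_transitionProfile (k : ℤ) :
    SmoothOn univ (hedgehog (transitionProfile k)) := by
  intro x _
  by_cases hx : x = 0
  · subst hx
    refine ((contDiffAt_const (c := Real.cos (k * Real.pi) • (vacuum : E4))).congr_of_eventuallyEq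
      ?_).contDiffWithinAt
    filter_upwards [Metric.ball_mem_nhds (0 : E3) one_pos] with y hy
    have hy1 : ‖y‖ ≤ 1 := (mem_ball_zero_iff.1 hy).le
    rw [hedgehog, coe_suspension, transitionProfile_of_le k hy1, Real.sin_int_mul_pi, zero_smul,
      add_zero]
  · exact ((isProfile_transitionProfile k).smoothOn_suspension contDiffOn_rayExtension_id
      x hx).contDiffAt (isOpen_compl_singleton.mem_nhds hx) |>.contDiffWithinAt

/-- The energy density is continuous, and it vanishes outside the ball of radius 2, where the field
is the vacuum. -/
theorem finiteEnergy_hedgehog_transitionProfile (k : ℤ) :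
    FiniteEnergy {0}ᶜ (hedgehog (transitionProfile k)) := by
  refine integrableOn_compl_zero.2 (Continuous.integrable_of_hasCompactSupport ?_ ?_)
  · have h1 : ContDiff ℝ ∞ (fun y => (hedgehog (transitionProfile k) y : E4)) :=
      contDiffOn_univ.1 (smoothOn_hedgehog_transitionProfile k)
    exact continuous_finsetSum _ fun i _ =>
      (((h1.continuous_fderiv (by simp)).clm_apply continuous_const).norm.pow 2)
  · refine HasCompactSupport.intro (isCompact_closedBall (0 : E3) 2) fun x hx => ?_
    have h1 : (fun y => (hedgehog (transitionProfile k) y : E4)) =ᶠ[𝓝 x]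
        fun _ => (vacuum : E4) := by
      filter_upwards [Metric.isClosed_closedBall.isOpen_compl.mem_nhds hx] with y hy
      have hy2 : 2 ≤ ‖y‖ := by
        have : ¬ ‖y‖ ≤ 2 := fun h => hy (mem_closedBall_zero_iff.2 h)
        linarith
      rw [hedgehog, coe_suspension, transitionProfile_of_ge k hy2]
      simp
    simp [energyDensity, partialD, h1.fderiv_eq]

theorem monotone_smoothTransition_sub_one : Monotone fun r : ℝ => Real.smoothTransition (r - 1) :=
  fun _ _ h => Real.smoothTransition.monotone (by linarith)

theorem antitone_transitionProfile {k : ℤ} (hk : 0 ≤ k) : Antitone (transitionProfile k) :=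
  fun r s h => mul_le_mul_of_nonneg_left
    (sub_le_sub_left (monotone_smoothTransition_sub_one h) 1)
    (mul_nonneg (by exact_mod_cast hk) Real.pi_nonneg)

theorem monotone_transitionProfile {k : ℤ} (hk : k ≤ 0) : Monotone (transitionProfile k) :=
  fun r s h => mul_le_mul_of_nonpos_left
    (sub_le_sub_left (monotone_smoothTransition_sub_one h) 1)
    (mul_nonpos_of_nonpos_of_nonneg (by exact_mod_cast hk) Real.pi_nonneg)

/-! ### Twists: rotations about an axis through a point, cut off to a ball -/

theorem basisVec_apply (i j : Fin 3) : basisVec i j = if j = i then 1 else 0 := by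
  simp [basisVec]

/-- The rotation of `ℝ³` about the `i`-th axis. -/
noncomputable def axisRotation (i : Fin 3) (θ : ℝ) (v : E3) : E3 :=
  Real.cos θ • v + Real.sin θ • cross (basisVec i) v + ((1 - Real.cos θ) * v i) • basisVec i

theorem axisRotation_zero (i : Fin 3) (v : E3) : axisRotation i 0 v = v := by
  simp [axisRotation]

theorem norm_axisRotation (i : Fin 3) (θ : ℝ) (v : E3) : ‖axisRotation i θ v‖ = ‖v‖ := by
  rw [← sq_eq_sq₀ (norm_nonneg _) (norm_nonneg _), ← real_inner_self_eq_norm_sq,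
    ← real_inner_self_eq_norm_sq, inner_eq_sum, inner_eq_sum]
  have h := Real.sin_sq_add_cos_sq θ
  fin_cases i <;>
    simp [axisRotation, cross_zero_apply, cross_one_apply, cross_two_apply, basisVec_apply]
  · linear_combination (v 1 ^ 2 + v 2 ^ 2) * h
  · linear_combination (v 0 ^ 2 + v 2 ^ 2) * h
  · linear_combination (v 0 ^ 2 + v 1 ^ 2) * h

theorem axisRotation_neg_axisRotation (i : Fin 3) (θ : ℝ) (v : E3) :
    axisRotation i (-θ) (axisRotation i θ v) = v := by
  have h := Real.sin_sq_add_cos_sq θ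
  fin_cases i <;> refine ext_three ?_ ?_ ?_ <;>
    simp [axisRotation, cross_zero_apply, cross_one_apply, cross_two_apply, basisVec_apply]
  · ring
  · linear_combination v 1 * h
  · linear_combination v 2 * h
  · linear_combination v 0 * h
  · ring
  · linear_combination v 2 * h
  · linear_combination v 0 * h
  · linear_combination v 1 * h
  · ring

/-- The twist at time `t`: `c + v ↦ c + rot(t η(|v|²)) v`. -/
noncomputable def twist (η : ℝ → ℝ) (c : E3) (i : Fin 3) (t : ℝ) (x : E3) : E3 :=
  c + axisRotation i (t * η (‖x - c‖ ^ 2)) (x - c)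

/-- The vector product with a fixed vector, as a continuous linear map. -/
noncomputable def crossL (a : E3) : E3 →L[ℝ] E3 := LinearMap.toContinuousLinearMap
  { toFun := cross a
    map_add' := cross_add_right a
    map_smul' := fun r v => cross_smul_right r a v }

theorem crossL_apply (a v : E3) : crossL a v = cross a v := rfl

section

variable {η : ℝ → ℝ} (hη : ContDiff ℝ ∞ η) (c : E3) (i : Fin 3)

/-- A twist preserves the distance to `c`, hence the angle of rotation, so reversing the time undoes
it. -/
theorem twist_neg_twist (η : ℝ → ℝ) (c : E3) (i : Fin 3) (t : ℝ) (x : E3) :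
    twist η c i (-t) (twist η c i t x) = x := by
  simp only [twist, add_sub_cancel_left, norm_axisRotation, neg_mul,
    axisRotation_neg_axisRotation, add_sub_cancel]

include hη

theorem contDiff_twist : ContDiff ℝ ∞ (fun p : ℝ × E3 => twist η c i p.1 p.2) := by
  have h1 : ContDiff ℝ ∞ (fun p : ℝ × E3 => p.2 - c) := contDiff_snd.sub contDiff_const
  have h2 : ContDiff ℝ ∞ (fun p : ℝ × E3 => p.1 * η (‖p.2 - c‖ ^ 2)) :=
    contDiff_fst.mul (hη.comp (h1.norm_sq ℝ))
  have h3 : ContDiff ℝ ∞ (fun p : ℝ × E3 => cross (basisVec i) (p.2 - c)) :=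
    (crossL (basisVec i)).contDiff.comp h1
  have h4 : ContDiff ℝ ∞ (fun p : ℝ × E3 => (p.2 - c) i) :=
    (EuclideanSpace.proj i : E3 →L[ℝ] ℝ).contDiff.comp h1
  exact contDiff_const.add (((h2.cos.smul h1).add (h2.sin.smul h3)).add
    (((contDiff_const.sub h2.cos).mul h4).smul contDiff_const))

/-- Twists as diffeomorphisms. -/
noncomputable def twistDiffeomorph (t : ℝ) : E3 ≃ₘ[ℝ] E3 where
  toFun := twist η c i t
  invFun := twist η c i (-t)
  left_inv := twist_neg_twist η c i t
  right_inv x := by simpa using twist_neg_twist η c i (-t) x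
  contMDiff_toFun :=
    ((contDiff_twist hη c i).comp (contDiff_const.prodMk contDiff_id)).contMDiff
  contMDiff_invFun :=
    ((contDiff_twist hη c i).comp (contDiff_const.prodMk contDiff_id)).contMDiff

/-- With `Q` the rotation and `e` the axis, the differential is `Q` plus the rank one map `w ↦ p ⟨v,
w⟩ e × Q v`. Its determinant is `1 + p ⟨v, e × v⟩ = 1`, since `Q` fixes `e`; this is checked here in
coordinates. -/
theorem det_fderiv_twist (t : ℝ) (x : E3) : (fderiv ℝ (twist η c i t) x).det = 1 := by
  set v := x - c with hv
  set θ := t * η (‖v‖ ^ 2) with hθ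
  -- The gradient of the angle `t η(|x - c|²)` is `p v`.
  set p := t * (deriv η (‖v‖ ^ 2) * 2) with hp
  have h1 : HasFDerivAt (fun y : E3 => y - c) (ContinuousLinearMap.id ℝ E3) x :=
    (hasFDerivAt_id x).sub_const c
  have h2 : HasFDerivAt (fun y : E3 => t * η (‖y - c‖ ^ 2)) (p • innerSL ℝ v) x := by
    have h3 := (((hη.differentiable (by simp)) (‖x - c‖ ^ 2)).hasDerivAt.comp_hasFDerivAt x
      h1.norm_sq).const_mul t
    refine h3.congr_fderiv ?_
    ext w
    simp [hp, ← hv]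
    ring
  have h3 : HasFDerivAt (fun y : E3 => cross (basisVec i) (y - c)) (crossL (basisVec i)) x := by
    have h := (crossL (basisVec i)).hasFDerivAt.comp x h1
    rwa [ContinuousLinearMap.comp_id] at h
  have h4 : HasFDerivAt (fun y : E3 => (y - c) i) (EuclideanSpace.proj i : E3 →L[ℝ] ℝ) x := by
    have h := (EuclideanSpace.proj i : E3 →L[ℝ] ℝ).hasFDerivAt.comp x h1
    rwa [ContinuousLinearMap.comp_id] at h
  have h5 : HasFDerivAt (twist η c i t) _ x :=
    ((((h2.cos.smul h1).add (h2.sin.smul h3)).add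
    (((h2.cos.const_sub 1).mul h4).smul_const (basisVec i))).const_add c)
  have h6 := Real.sin_sq_add_cos_sq θ
  rw [h5.fderiv, det_eq_matrix_det, Matrix.det_fin_three]
  have hin : ∀ j, inner ℝ v (basisVec j) = v j := fun j => by
    simp [basisVec, EuclideanSpace.inner_single_right]
  simp only [← hv, ← hθ, Matrix.of_apply, add_apply, smul_apply, ContinuousLinearMap.smulRight_apply,
    neg_apply, innerSL_apply_apply, ContinuousLinearMap.id_apply, crossL_apply, PiLp.add_apply,
    PiLp.smul_apply, smul_eq_mul, hin, PiLp.proj_apply]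
  fin_cases i <;>
    simp [cross_zero_apply, cross_one_apply, cross_two_apply, basisVec_apply] <;>
    linear_combination h6

theorem isSDiffCurve_twistDiffeomorph {U : Set E3} {ρ : ℝ} (hρ : 0 ≤ ρ)
    (hηρ : ∀ s, ρ ^ 2 ≤ s → η s = 0) (hU : Metric.closedBall c ρ ⊆ U) :
    IsSDiffCurve U (twistDiffeomorph hη c i) where
  smooth := contDiff_twist hη c i
  zero x := by
    change twist η c i 0 x = x
    simp [twist, axisRotation_zero]
  support := by
    refine ⟨Metric.closedBall c ρ, isCompact_closedBall c ρ, hU, fun t x hx => ?_⟩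
    change twist η c i t x = x
    have h1 : ρ < ‖x - c‖ := by
      rw [mem_closedBall_iff_norm] at hx
      exact lt_of_not_ge hx
    rw [twist, hηρ _ (by gcongr), mul_zero, axisRotation_zero, add_sub_cancel]
  volume_preserving t x := det_fderiv_twist hη c i t x

theorem velocity_twistDiffeomorph :
    IsSDiffCurve.velocity (twistDiffeomorph hη c i) =
      fun x => η (‖x - c‖ ^ 2) • cross (basisVec i) (x - c) := by
  funext x
  have h1 : HasDerivAt (fun t => twistDiffeomorph hη c i t x)
      (IsSDiffCurve.velocity (twistDiffeomorph hη c i) x) 0 := by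
    have h2 : HasDerivAt (fun t : ℝ => (t, x)) (1, 0) 0 :=
      (hasDerivAt_id 0).prodMk (hasDerivAt_const 0 x)
    exact (((contDiff_twist hη c i).differentiable (by simp) (0, x)).hasFDerivAt).comp_hasDerivAt
      0 h2
  have h3 : HasDerivAt (fun t : ℝ => t * η (‖x - c‖ ^ 2)) (η (‖x - c‖ ^ 2)) 0 := by
    simpa using (hasDerivAt_id (0 : ℝ)).mul_const (η (‖x - c‖ ^ 2))
  have h4 : HasDerivAt (fun t => twist η c i t x) _ 0 :=
    ((((h3.cos.smul_const (x - c)).add (h3.sin.smul_const (cross (basisVec i) (x - c)))).add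
    (((h3.cos.const_sub 1).mul_const ((x - c) i)).smul_const (basisVec i))).const_add c)
  rw [h1.unique h4]
  simp

end

/-! ### The conformal factor of a restricted harmonic suspension -/

theorem tsupport_subset_of_eq_zero {α β : Type*} [TopologicalSpace α] [Zero β] {F : α → β}
    {K : Set α} (hK : IsClosed K) (hF : ∀ x ∉ K, F x = 0) : tsupport F ⊆ K :=
  closure_minimal (fun x hx => by_contra fun h => hx (hF x h)) hK

/-- For a bump `ζ = Z(|x - c|²)`, `∂_w ζ = 2 Z'(|x - c|²) ⟨w, x - c⟩`. The hypothesis with `η = Z'`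
is therefore the weak form of `∫ ζ ∂_w g = 0`, impossible if `∂_w g(c) ≠ 0` and the bump is
supported where `∂_w g` keeps its sign. -/
theorem fderiv_apply_eq_zero_of_integral_bump {V : Set E3} (hV : IsOpen V) {g : E3 → ℝ}
    (hg : ContDiffOn ℝ 1 g V) {c : E3} (hc : c ∈ V) (w : E3)
    (H : ∀ ρ : ℝ, 0 < ρ → Metric.closedBall c ρ ⊆ V → ∀ η : ℝ → ℝ, ContDiff ℝ ∞ η →
      (∀ s, ρ ^ 2 ≤ s → η s = 0) →
      ∫ x, g x * (η (‖x - c‖ ^ 2) * inner ℝ w (x - c)) = 0) :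
    fderiv ℝ g c w = 0 := by
  by_contra ha
  set a := fderiv ℝ g c w with hadef
  have hdg : ContinuousOn (fun x => fderiv ℝ g x w) V :=
    (hg.continuousOn_fderiv_of_isOpen hV le_rfl).clm_apply continuousOn_const
  have hpos : ∀ᶠ x in 𝓝 c, x ∈ V ∧ 0 < a * fderiv ℝ g x w := by
    refine (hV.eventually_mem hc).and ?_
    have h1 : ContinuousAt (fun x => a * fderiv ℝ g x w) c :=
      continuousAt_const.mul (hdg.continuousAt (hV.mem_nhds hc))
    exact h1.eventually (lt_mem_nhds (mul_self_pos.2 ha))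
  obtain ⟨ρ, hρ, hball⟩ := Metric.nhds_basis_closedBall.mem_iff.1 hpos
  set Z : ℝ → ℝ := fun s => Real.smoothTransition (1 - s / ρ ^ 2) with hZ
  have hZs : ContDiff ℝ ∞ Z :=
    Real.smoothTransition.contDiff.comp (contDiff_const.sub (contDiff_id.div_const _))
  have hZ0 : ∀ s, ρ ^ 2 ≤ s → Z s = 0 := fun s hs =>
    Real.smoothTransition.zero_of_nonpos (by rw [sub_nonpos, one_le_div (by positivity)]; exact hs)
  have hZnn : ∀ s, 0 ≤ Z s := fun s => Real.smoothTransition.nonneg _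
  -- The endpoint `s = ρ²` is included: `Z` is nonnegative and attains its minimum `0` there.
  have hη0 : ∀ s, ρ ^ 2 ≤ s → deriv Z s = 0 := fun s hs =>
    IsLocalMin.deriv_eq_zero (Eventually.of_forall fun t => by rw [hZ0 s hs]; exact hZnn t)
  have hηs : ContDiff ℝ ∞ (deriv Z) := by
    have : ContDiff ℝ (∞ + 1) Z := hZs
    exact (contDiff_succ_iff_deriv.1 this).2.2
  set ζ : E3 → ℝ := fun x => Z (‖x - c‖ ^ 2) with hζ
  have hζs : ContDiff ℝ ∞ ζ := hZs.comp ((contDiff_id.sub contDiff_const).norm_sq ℝ)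
  have hout : ∀ x ∉ Metric.closedBall c ρ, ρ ^ 2 ≤ ‖x - c‖ ^ 2 := fun x hx => by
    rw [mem_closedBall_iff_norm] at hx
    have := lt_of_not_ge hx
    gcongr
  have hint : ∀ {F : E3 → ℝ}, ContinuousOn F V → (∀ x ∉ Metric.closedBall c ρ, F x = 0) →
      Continuous F ∧ HasCompactSupport F := fun {F} hF hF0 =>
    ⟨continuous_of_tsupport fun x hx =>
      hF.continuousAt (hV.mem_nhds (hball (tsupport_subset_of_eq_zero Metric.isClosed_closedBall hF0 hx)).1),
     HasCompactSupport.intro (isCompact_closedBall c ρ) hF0⟩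
  have hζ0 : ∀ x ∉ Metric.closedBall c ρ, ζ x = 0 := fun x hx => hZ0 _ (hout x hx)
  have hdζ : ∀ x, fderiv ℝ ζ x w = 2 * (deriv Z (‖x - c‖ ^ 2) * inner ℝ w (x - c)) := by
    intro x
    have h1 : HasFDerivAt (fun y : E3 => y - c) (ContinuousLinearMap.id ℝ E3) x :=
      (hasFDerivAt_id x).sub_const c
    have h2 := ((hZs.differentiable (by simp)) (‖x - c‖ ^ 2)).hasDerivAt.comp_hasFDerivAt x h1.norm_sq
    rw [show fderiv ℝ ζ x = _ from h2.fderiv, real_inner_comm]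
    simp [inner_sub_left]
    ring
  have hX : ContDiff ℝ 1 (fun x => ζ x • w) := (hζs.of_le (by simp)).smul contDiff_const
  have hXc : HasCompactSupport (fun x => ζ x • w) :=
    HasCompactSupport.intro (isCompact_closedBall c ρ) fun x hx => by rw [hζ0 x hx, zero_smul]
  have hXV : tsupport (fun x => ζ x • w) ⊆ V :=
    (tsupport_subset_of_eq_zero Metric.isClosed_closedBall fun x hx => by
      rw [hζ0 x hx, zero_smul]).trans fun x hx => (hball hx).1
  have hibp := integral_fderiv_apply_add_mul_divergence hV hg hX hXc hXV
  obtain ⟨hc1, hs1⟩ := hint (F := fun x => ζ x * fderiv ℝ g x w)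
    (hζs.continuous.continuousOn.mul hdg) fun x hx => by simp [hζ0 x hx]
  obtain ⟨hc2, hs2⟩ := hint
    (F := fun x => g x * (deriv Z (‖x - c‖ ^ 2) * inner ℝ w (x - c)))
    (hg.continuousOn.mul (((hηs.continuous.comp (by fun_prop : Continuous fun x : E3 =>
      ‖x - c‖ ^ 2)).mul (by fun_prop)).continuousOn)) fun x hx => by simp [hη0 _ (hout x hx)]
  have hzero : ∫ x, ζ x * fderiv ℝ g x w = 0 := by
    have h1 : ∀ x, fderiv ℝ g x (ζ x • w) + g x * divergence (fun y => ζ y • w) x =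
        ζ x * fderiv ℝ g x w +
          2 * (g x * (deriv Z (‖x - c‖ ^ 2) * inner ℝ w (x - c))) := fun x => by
      rw [divergence_smul (X := fun _ => w) (hζs.differentiable (by simp) x)
        (differentiableAt_const w), hdζ]
      simp [divergence]
      ring
    simp only [h1] at hibp
    rw [integral_add (hc1.integrable_of_hasCompactSupport hs1)
      ((hc2.integrable_of_hasCompactSupport hs2).const_mul 2), integral_const_mul,
      H ρ hρ (fun x hx => (hball hx).1) _ hηs hη0] at hibp
    simpa using hibp
  have hnn : ∀ x, 0 ≤ a * (ζ x * fderiv ℝ g x w) := fun x => by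
    by_cases hx : x ∈ Metric.closedBall c ρ
    · have := (hball hx).2.le
      calc 0 ≤ ζ x * (a * fderiv ℝ g x w) := mul_nonneg (hZnn _) this
        _ = _ := by ring
    · simp [hζ0 x hx]
  have hca : Continuous fun x => a * (ζ x * fderiv ℝ g x w) := continuous_const.mul hc1
  have hp := hca.integral_pos_of_hasCompactSupport_nonneg_nonzero (μ := volume) (x := c)
    hs1.mul_left hnn (by
      have hζc : ζ c = 1 := by simp [hζ, hZ]
      rw [hζc, one_mul]
      exact mul_ne_zero ha ha)
  rw [integral_const_mul, hzero, mul_zero] at hp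
  exact lt_irrefl _ hp

/-! ### Radial functions and the homogeneity of the conformal factor -/

theorem contDiffOn_comp_norm {P : ℝ → ℝ} (hP : ContDiffOn ℝ ∞ P (Ioi 0)) :
    ContDiffOn ℝ ∞ (fun x : E3 => P ‖x‖) {0}ᶜ := fun x hx =>
  ((hP.contDiffAt (Ioi_mem_nhds (norm_pos_iff.2 hx))).comp x
    (contDiffAt_norm ℝ hx)).contDiffWithinAt

theorem fderiv_comp_norm {P : ℝ → ℝ} {x : E3} (hx : x ≠ 0) (hP : DifferentiableAt ℝ P ‖x‖)
    (v : E3) : fderiv ℝ (fun y : E3 => P ‖y‖) x v = deriv P ‖x‖ * (inner ℝ x v / ‖x‖) := by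
  have h : HasFDerivAt (fun y : E3 => P ‖y‖) _ x :=
    hP.hasDerivAt.comp_hasFDerivAt x (hasFDerivAt_norm hx)
  rw [h.fderiv]
  simp only [smul_apply, innerSL_apply_apply, smul_eq_mul]
  ring

theorem contDiffOn_conformalFactor {R : S2 → S2} (hR : ContDiffOn ℝ ∞ (rayExtension R) {0}ᶜ) :
    ContDiffOn ℝ ∞ (conformalFactor R) {0}ᶜ := by
  have h1 : ContDiffOn ℝ ∞ (fderiv ℝ (rayExtension R)) {0}ᶜ :=
    hR.fderiv_of_isOpen isOpen_compl_singleton (by simp)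
  have h2 : ContDiffOn ℝ ∞ (fun x : E3 => ‖x‖ ^ 2) {0}ᶜ := (contDiff_norm_sq ℝ).contDiffOn
  exact (contDiffOn_const.mul h2).mul (ContDiffOn.sum fun i _ =>
    (h1.clm_apply contDiffOn_const).norm_sq ℝ)

section

variable {R : S2 → S2} (hR : ContDiffOn ℝ ∞ (rayExtension R) {0}ᶜ)
include hR

theorem differentiableAt_conformalFactor {x : E3} (hx : x ≠ 0) :
    DifferentiableAt ℝ (conformalFactor R) x :=
  ((contDiffOn_conformalFactor hR x hx).contDiffAt
    (isOpen_compl_singleton.mem_nhds hx)).differentiableAt (by simp)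

theorem conformalFactor_smul {x : E3} (hx : x ≠ 0) {t : ℝ} (ht : 0 < t) :
    conformalFactor R (t • x) = conformalFactor R x := by
  rw [conformalFactor_eq hR (smul_ne_zero ht.ne' hx), direction_smul hx ht,
    ← conformalFactor_eq hR hx]

theorem fderiv_conformalFactor_smul {x : E3} (hx : x ≠ 0) {t : ℝ} (ht : 0 < t) (v : E3) :
    fderiv ℝ (conformalFactor R) x v = t * fderiv ℝ (conformalFactor R) (t • x) v := by
  have h1 : HasFDerivAt (fun y : E3 => t • y) (t • ContinuousLinearMap.id ℝ E3) x :=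
    (t • ContinuousLinearMap.id ℝ E3).hasFDerivAt
  have h2 := ((differentiableAt_conformalFactor hR (smul_ne_zero ht.ne' hx)).hasFDerivAt).comp x h1
  have h3 : conformalFactor R =ᶠ[𝓝 x] (conformalFactor R ∘ fun y : E3 => t • y) := by
    filter_upwards [isOpen_compl_singleton.mem_nhds hx] with y hy
    exact (conformalFactor_smul hR hy ht).symm
  rw [(h2.congr_of_eventuallyEq h3).fderiv]
  simp

theorem fderiv_conformalFactor_self {x : E3} (hx : x ≠ 0) :
    fderiv ℝ (conformalFactor R) x x = 0 := by
  have h1 : HasDerivAt (fun t : ℝ => t • x) ((1 : ℝ) • x) 1 := (hasDerivAt_id 1).smul_const x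
  have h2 : HasFDerivAt (conformalFactor R) (fderiv ℝ (conformalFactor R) x) ((1 : ℝ) • x) := by
    rw [one_smul]; exact (differentiableAt_conformalFactor hR hx).hasFDerivAt
  have h3 := h2.comp_hasDerivAt (1 : ℝ) h1
  have h4 : (conformalFactor R ∘ fun t : ℝ => t • x) =ᶠ[𝓝 1] fun _ => conformalFactor R x := by
    filter_upwards [lt_mem_nhds (zero_lt_one (α := ℝ))] with t ht using conformalFactor_smul hR hx ht
  have h5 := (h3.congr_of_eventuallyEq h4.symm).unique (hasDerivAt_const _ _)
  rwa [one_smul] at h5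

end

/-! ### First variation along twists -/

/-- This is `-c × (c × v) = |c|² v - ⟨c, v⟩ c` with `c × v` expanded in coordinates. It shows that
for `c ≠ 0` a linear map killing `c` and every `c × e_i` is zero. -/
theorem cross_cross_self (c v : E3) :
    (inner ℝ c c : ℝ) • v = (inner ℝ c v : ℝ) • c +
      ∑ i, (-(cross c v i)) • cross c (basisVec i) := by
  simp only [inner_eq_sum]
  refine ext_three ?_ ?_ ?_ <;>
    simp [Fin.sum_univ_three, cross_zero_apply, cross_one_apply, cross_two_apply,
      basisVec_apply] <;> ring

/-- The operator `r d/dr + 4` on functions of the radius. -/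
noncomputable def eulerFour (B : ℝ → ℝ) (r : ℝ) : ℝ := r * deriv B r + 4 * B r

theorem contDiffOn_eulerFour {B : ℝ → ℝ} (hB : ContDiffOn ℝ ∞ B (Ioi 0)) :
    ContDiffOn ℝ ∞ (eulerFour B) (Ioi 0) :=
  (contDiffOn_id.mul (hB.deriv_of_isOpen isOpen_Ioi (by simp))).add (contDiffOn_const.mul hB)

/-- Criticality along a twist supported away from the origin, after the adjoint formula for `β = B₁
- B₂ C`, `C` the conformal factor. As `C` is constant on rays, `x · ∇ + 4` acts only on the radial
coefficients. -/
theorem integral_eulerFour_mul_eq_zero {k : ℤ} {f : ℝ → ℝ} {R : S2 → S2} (hf : IsProfile k f)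
    (hR : IsHolomorphic R) (H : RestrictedHarmonic {0}ᶜ (suspension f R)) {B₁ B₂ : ℝ → ℝ}
    (hB₁ : B₁ = fun r => deriv f r ^ 2 / r ^ 2) (hB₂ : B₂ = fun r => Real.sin (f r) ^ 2 / r ^ 4)
    (hB₁s : ContDiffOn ℝ ∞ B₁ (Ioi 0)) (hB₂s : ContDiffOn ℝ ∞ B₂ (Ioi 0))
    {c : E3} (i : Fin 3) {ρ : ℝ} (hρ : 0 < ρ) (hball : Metric.closedBall c ρ ⊆ {0}ᶜ)
    {η : ℝ → ℝ} (hη : ContDiff ℝ ∞ η) (hη0 : ∀ s, ρ ^ 2 ≤ s → η s = 0) :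
    ∫ x, (eulerFour B₁ ‖x‖ - eulerFour B₂ ‖x‖ * conformalFactor R x) *
      (η (‖x - c‖ ^ 2) * inner ℝ (cross c (basisVec i)) (x - c)) = 0 := by
  have hψ := isSDiffCurve_twistDiffeomorph hη c i hρ.le hη0 hball
  obtain ⟨h1, h2⟩ := hasDerivAt_dirichletEnergy_comp hψ H.smooth (integrableOn_compl_zero.1 H.finite)
  have h3 := H.critical _ hψ
  simp only [dirichletEnergy_compl_zero] at h3
  have h4 := h2.unique h3
  set X := IsSDiffCurve.velocity (twistDiffeomorph hη c i) with hXdef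
  have hX : X = fun x => η (‖x - c‖ ^ 2) • cross (basisVec i) (x - c) :=
    velocity_twistDiffeomorph hη c i
  -- In `⟨x, e_i × (x - c)⟩` the part `x - c` of the first factor drops out, and the triple product
  -- is then permuted cyclically.
  have hu : ∀ x, radialPart X x = η (‖x - c‖ ^ 2) * inner ℝ (cross c (basisVec i)) (x - c) := by
    intro x
    rw [radialPart, hX]
    simp only [inner_smul_right, inner_eq_sum, cross_zero_apply, cross_one_apply, cross_two_apply,
      PiLp.sub_apply]
    ring
  have hXs : ContDiff ℝ ∞ X := hψ.contDiff_velocity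
  have hXc : HasCompactSupport X := hψ.hasCompactSupport_velocity
  set β : E3 → ℝ := fun x => B₁ ‖x‖ - B₂ ‖x‖ * conformalFactor R x with hβ
  have hβs : ContDiffOn ℝ ∞ β {0}ᶜ := (contDiffOn_comp_norm hB₁s).sub
    ((contDiffOn_comp_norm hB₂s).mul (contDiffOn_conformalFactor hR.smooth))
  have heq : firstVariation (suspension f R) X =ᵐ[volume]
      fun x => β x * (fderiv ℝ (radialPart X) x x - radialPart X x) := by
    filter_upwards [ae_ne_zero] with x hx
    refine firstVariation_eq (fun v w => ?_) (hXs.differentiable (by simp) x)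
      (hψ.divergence_velocity x) (μ := Real.sin (f ‖x‖) ^ 2 * conformalFactor R x / ‖x‖ ^ 2)
    rw [inner_diff_suspension hR hx (hf.differentiableAt (norm_pos_iff.2 hx))]
    simp only [hβ, hB₁, hB₂]
    ring
  have hu0 : ∀ x ∉ Metric.closedBall c ρ, radialPart X x = 0 := fun x hx => by
    rw [mem_closedBall_iff_norm] at hx
    have h5 := lt_of_not_ge hx
    rw [hu, hη0 _ (by gcongr), zero_mul]
  have hsub : tsupport (radialPart X) ⊆ {0}ᶜ :=
    (tsupport_subset_of_eq_zero Metric.isClosed_closedBall hu0).trans hball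
  rw [integral_congr_ae heq, integral_mul_euler_sub_self isOpen_compl_singleton
    (hβs.of_le (by simp)) ((contDiff_radialPart hXs).of_le (by simp))
    (hasCompactSupport_radialPart hXc) hsub, neg_eq_zero] at h4
  rw [← h4]
  refine integral_congr_ae ?_
  filter_upwards [ae_ne_zero] with x hx
  have hr : 0 < ‖x‖ := norm_pos_iff.2 hx
  have hd₁ : DifferentiableAt ℝ B₁ ‖x‖ :=
    (hB₁s.contDiffAt (Ioi_mem_nhds hr)).differentiableAt (by simp)
  have hd₂ : DifferentiableAt ℝ B₂ ‖x‖ :=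
    (hB₂s.contDiffAt (Ioi_mem_nhds hr)).differentiableAt (by simp)
  have hn : DifferentiableAt ℝ (fun y : E3 => ‖y‖) x := (hasFDerivAt_norm hx).differentiableAt
  have hd₁' : DifferentiableAt ℝ (fun y : E3 => B₁ ‖y‖) x := hd₁.comp x hn
  have hd₂' : DifferentiableAt ℝ (fun y : E3 => B₂ ‖y‖) x := hd₂.comp x hn
  have hcf := differentiableAt_conformalFactor hR.smooth hx
  rw [hu]
  congr 1
  have h6 : fderiv ℝ β x x = deriv B₁ ‖x‖ * ‖x‖ - deriv B₂ ‖x‖ * ‖x‖ * conformalFactor R x := by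
    have h7 : HasFDerivAt β _ x :=
      hd₁'.hasFDerivAt.sub (hd₂'.hasFDerivAt.mul hcf.hasFDerivAt)
    rw [h7.fderiv]
    simp only [sub_apply, add_apply, smul_apply, fderiv_conformalFactor_self hR.smooth hx,
      fderiv_comp_norm hx hd₁, fderiv_comp_norm hx hd₂, real_inner_self_eq_norm_sq, smul_eq_mul]
    field_simp
    ring
  rw [h6, eulerFour, eulerFour, hβ]
  ring

/-- The function paired with the twists has zero derivative at `c` in each direction `c × e_i`.
These are tangent to the sphere through `c`, so the radial coefficients are not differentiated.
Radially the conformal factor is constant anyway. -/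
theorem fderiv_conformalFactor_eq_zero {k : ℤ} {f : ℝ → ℝ} {R : S2 → S2} (hf : IsProfile k f)
    (hR : IsHolomorphic R) (H : RestrictedHarmonic {0}ᶜ (suspension f R)) {c : E3} (hc : c ≠ 0)
    (hs : deriv (fun r => Real.sin (f r) ^ 2) ‖c‖ ≠ 0) : fderiv ℝ (conformalFactor R) c = 0 := by
  have hr : 0 < ‖c‖ := norm_pos_iff.2 hc
  set B₁ : ℝ → ℝ := fun r => deriv f r ^ 2 / r ^ 2 with hB₁
  set B₂ : ℝ → ℝ := fun r => Real.sin (f r) ^ 2 / r ^ 4 with hB₂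
  have hfs : ContDiffOn ℝ ∞ f (Ioi 0) := hf.smooth.mono Ioi_subset_Ici_self
  have hB₁s : ContDiffOn ℝ ∞ B₁ (Ioi 0) :=
    ((hfs.deriv_of_isOpen isOpen_Ioi (by simp)).pow 2).div (contDiffOn_id.pow 2)
      fun r hr => pow_ne_zero 2 (ne_of_gt hr)
  have hB₂s : ContDiffOn ℝ ∞ B₂ (Ioi 0) :=
    ((Real.contDiff_sin.comp_contDiffOn hfs).pow 2).div (contDiffOn_id.pow 4)
      fun r hr => pow_ne_zero 4 (ne_of_gt hr)
  have hE₁ := contDiffOn_eulerFour hB₁s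
  have hE₂ := contDiffOn_eulerFour hB₂s
  -- `(r d/dr + 4)(r⁻⁴ S) = r⁻³ S'` for `S = sin² f`.
  have hQ : eulerFour B₂ ‖c‖ ≠ 0 := by
    have hds : DifferentiableAt ℝ (fun r => Real.sin (f r) ^ 2) ‖c‖ :=
      ((hf.differentiableAt hr).sin).pow 2
    have h1 : HasDerivAt B₂ _ ‖c‖ := hds.hasDerivAt.div (hasDerivAt_pow 4 ‖c‖) (by positivity)
    have h2 : eulerFour B₂ ‖c‖ = deriv (fun r => Real.sin (f r) ^ 2) ‖c‖ / ‖c‖ ^ 3 := by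
      rw [eulerFour, h1.deriv, hB₂]
      field_simp
      ring
    rw [h2]
    exact div_ne_zero hs (by positivity)
  have hgs : ContDiffOn ℝ ∞ (fun x : E3 => eulerFour B₁ ‖x‖ - eulerFour B₂ ‖x‖ * conformalFactor R x)
      {0}ᶜ := (contDiffOn_comp_norm hE₁).sub
    ((contDiffOn_comp_norm hE₂).mul (contDiffOn_conformalFactor hR.smooth))
  have hd₁ : DifferentiableAt ℝ (eulerFour B₁) ‖c‖ :=
    (hE₁.contDiffAt (Ioi_mem_nhds hr)).differentiableAt (by simp)
  have hd₂ : DifferentiableAt ℝ (eulerFour B₂) ‖c‖ :=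
    (hE₂.contDiffAt (Ioi_mem_nhds hr)).differentiableAt (by simp)
  have hn : DifferentiableAt ℝ (fun y : E3 => ‖y‖) c := (hasFDerivAt_norm hc).differentiableAt
  have hd₁' : DifferentiableAt ℝ (fun y : E3 => eulerFour B₁ ‖y‖) c := hd₁.comp c hn
  have hd₂' : DifferentiableAt ℝ (fun y : E3 => eulerFour B₂ ‖y‖) c := hd₂.comp c hn
  have hcf := differentiableAt_conformalFactor hR.smooth hc
  have htan : ∀ i, fderiv ℝ (conformalFactor R) c (cross c (basisVec i)) = 0 := by
    intro i
    have h1 := fderiv_apply_eq_zero_of_integral_bump isOpen_compl_singleton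
      (hgs.of_le (by simp)) (c := c) hc (cross c (basisVec i))
      fun ρ hρ hball η hη hη0 =>
        integral_eulerFour_mul_eq_zero hf hR H hB₁ hB₂ hB₁s hB₂s i hρ hball hη hη0
    have h2 : HasFDerivAt
        (fun x : E3 => eulerFour B₁ ‖x‖ - eulerFour B₂ ‖x‖ * conformalFactor R x) _ c :=
      hd₁'.hasFDerivAt.sub (hd₂'.hasFDerivAt.mul hcf.hasFDerivAt)
    rw [h2.fderiv] at h1
    simp only [sub_apply, add_apply, smul_apply, fderiv_comp_norm hc hd₁, fderiv_comp_norm hc hd₂,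
      inner_cross_left, smul_eq_mul, zero_div, mul_zero, zero_sub, add_zero, neg_eq_zero] at h1
    exact (mul_eq_zero.1 h1).resolve_left hQ
  ext v
  have h1 := congrArg (fderiv ℝ (conformalFactor R) c) (cross_cross_self c v)
  simp only [map_add, map_smul, map_sum, htan, fderiv_conformalFactor_self hR.smooth hc,
    smul_eq_mul] at h1
  rw [real_inner_self_eq_norm_sq] at h1
  simpa [hc] using h1

/-- One radius with `(sin² f)' ≠ 0` suffices: the differential vanishes on that sphere, hence
everywhere by homogeneity, and the punctured space is connected. -/
theorem conformalFactor_const_of_restrictedHarmonic {k : ℤ} {f : ℝ → ℝ} {R : S2 → S2}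
    (hf : IsProfile k f) (hR : IsHolomorphic R) (H : RestrictedHarmonic {0}ᶜ (suspension f R))
    {r : ℝ} (hr : 0 < r) (hs : deriv (fun r => Real.sin (f r) ^ 2) r ≠ 0) {x y : E3}
    (hx : x ≠ 0) (hy : y ≠ 0) : conformalFactor R x = conformalFactor R y := by
  have hconn : IsPreconnected ({0}ᶜ : Set E3) :=
    (isConnected_compl_singleton_of_one_lt_rank
      (Module.lt_rank_of_lt_finrank (by simp)) 0).isPreconnected
  refine isOpen_compl_singleton.is_const_of_fderiv_eq_zero (𝕜 := ℝ) hconn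
    (fun z hz => (differentiableAt_conformalFactor hR.smooth hz).differentiableWithinAt)
    (fun z hz => ?_) hx hy
  have hz0 : 0 < ‖z‖ := norm_pos_iff.2 hz
  ext v
  rw [fderiv_conformalFactor_smul hR.smooth hz (div_pos hr hz0) v,
    fderiv_conformalFactor_eq_zero hf hR H (smul_ne_zero (div_pos hr hz0).ne' hz)]
  · simp
  · rw [norm_smul, Real.norm_of_nonneg (div_pos hr hz0).le, div_mul_cancel₀ _ hz0.ne']
    exact hs

/-! ### Holomorphic maps with constant conformal factor -/

theorem exists_eq_cos_smul_add_sin_smul {p n : E3} (hp : ‖p‖ = 1) (hn : ‖n‖ = 1) :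
    ∃ (t : ℝ) (v : E3), ‖v‖ = 1 ∧ inner ℝ p v = 0 ∧ n = Real.cos t • p + Real.sin t • v := by
  set a : ℝ := inner ℝ p n with ha
  set w := n - a • p with hw
  have hpp : inner ℝ p p = (1 : ℝ) := by rw [real_inner_self_eq_norm_sq, hp, one_pow]
  have hpw : inner ℝ p w = 0 := by
    rw [hw, inner_sub_right, inner_smul_right, hpp, ← ha]; ring
  have hww : ‖w‖ ^ 2 = 1 - a ^ 2 := by
    rw [hw, norm_sub_sq_real, hn, norm_smul, hp, inner_smul_right, real_inner_comm p n, ← ha,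
      Real.norm_eq_abs, mul_one, sq_abs]
    ring
  have ha1 : a ^ 2 ≤ 1 := by nlinarith [sq_nonneg ‖w‖]
  have hcos : Real.cos (Real.arccos a) = a :=
    Real.cos_arccos (by nlinarith) (by nlinarith)
  have hsin : Real.sin (Real.arccos a) = ‖w‖ := by
    rw [Real.sin_arccos, ← hww, Real.sqrt_sq (norm_nonneg w)]
  by_cases h0 : w = 0
  · obtain ⟨e, he, hpe⟩ := exists_unit_orthogonal p
    refine ⟨Real.arccos a, e, he, hpe, ?_⟩
    rw [hcos, hsin, h0, norm_zero, zero_smul, add_zero]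
    exact sub_eq_zero.1 h0
  · refine ⟨Real.arccos a, ‖w‖⁻¹ • w, by simp [norm_smul, h0], by
      rw [inner_smul_right, hpw, mul_zero], ?_⟩
    rw [hcos, hsin, smul_smul, mul_inv_cancel₀ (norm_ne_zero_iff.2 h0), one_smul, hw]
    abel

/-- Undoing the expected rotation in the `(y, z)` plane gives two quantities with zero derivative;
solving for `y` yields the formula. -/
theorem eq_cos_smul_add_sin_smul_of_hasDerivAt {E : Type*} [NormedAddCommGroup E]
    [NormedSpace ℝ E] {y z : ℝ → E} {q : ℝ} (hq : q ≠ 0) (hy : ∀ t, HasDerivAt y (z t) t)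
    (hz : ∀ t, HasDerivAt z (-(q ^ 2) • y t) t) (t : ℝ) :
    y t = Real.cos (q * t) • y 0 + (Real.sin (q * t) / q) • z 0 := by
  have hqt : ∀ t, HasDerivAt (fun t : ℝ => q * t) q t := fun t => by
    simpa using (hasDerivAt_id t).const_mul q
  have hA : ∀ t, HasDerivAt (fun t => Real.cos (q * t) • y t - (Real.sin (q * t) / q) • z t)
      0 t := fun t => by
    refine (((hqt t).cos.smul (hy t)).sub (((hqt t).sin.div_const q).smul (hz t))).congr_deriv ?_
    rw [smul_smul]
    have h1 : Real.cos (q * t) * q / q = Real.cos (q * t) := by field_simp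
    have h2 : Real.sin (q * t) / q * -(q ^ 2) = -Real.sin (q * t) * q := by field_simp
    rw [h1, h2]
    abel
  have hB : ∀ t, HasDerivAt (fun t => (q * Real.sin (q * t)) • y t + Real.cos (q * t) • z t)
      0 t := fun t => by
    refine ((((hqt t).sin.const_mul q).smul (hy t)).add ((hqt t).cos.smul (hz t))).congr_deriv ?_
    rw [smul_smul]
    module
  have hA' := is_const_of_deriv_eq_zero (fun t => (hA t).differentiableAt) (fun t => (hA t).deriv) t 0
  have hB' := is_const_of_deriv_eq_zero (fun t => (hB t).differentiableAt) (fun t => (hB t).deriv) t 0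
  simp only [mul_zero, Real.cos_zero, Real.sin_zero, zero_div, zero_smul, one_smul, sub_zero,
    zero_add] at hA' hB'
  rw [← hA', ← hB']
  have h1 := Real.sin_sq_add_cos_sq (q * t)
  have h2 : y t = (Real.sin (q * t) ^ 2 + Real.cos (q * t) ^ 2) • y t := by rw [h1, one_smul]
  conv_lhs => rw [h2]
  match_scalars
  · field_simp
    ring
  · field_simp
    ring

section

variable {R : S2 → S2} (hR : IsHolomorphic R) {c : ℝ}
  (hc : ∀ x : E3, x ≠ 0 → conformalFactor R x = c)
include hR hc

theorem inner_fderiv_of_const {x : E3} (hx : ‖x‖ = 1) (v w : E3) :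
    inner ℝ (fderiv ℝ (rayExtension R) x v) (fderiv ℝ (rayExtension R) x w) =
      c * (inner ℝ v w - inner ℝ x v * inner ℝ x w) := by
  have hx0 : x ≠ 0 := fun h => by simp [h] at hx
  rw [hR.inner_fderiv hx0, hc x hx0, hx]
  simp

theorem norm_fderiv_sq_of_const {x : E3} (hx : ‖x‖ = 1) {v : E3} (hv : ‖v‖ = 1)
    (hxv : inner ℝ x v = 0) : ‖fderiv ℝ (rayExtension R) x v‖ ^ 2 = c := by
  rw [← real_inner_self_eq_norm_sq, inner_fderiv_of_const hR hc hx, hxv,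
    real_inner_self_eq_norm_sq, hv]
  ring

/-- Differentiate the conformality relation along `x + t u`. Because `u`, `v`, `w` are orthogonal to
`x`, its right-hand side depends on `t` only through `t²`, so its derivative at `0` is zero. -/
theorem inner_second_fderiv_add {x : E3} (hx : ‖x‖ = 1) {u v w : E3} (hu : inner ℝ x u = 0)
    (hv : inner ℝ x v = 0) (hw : inner ℝ x w = 0) :
    inner ℝ (fderiv ℝ (rayExtension R) x v)
        (fderiv ℝ (fderiv ℝ (rayExtension R)) x u w) +
      inner ℝ (fderiv ℝ (fderiv ℝ (rayExtension R)) x u v)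
        (fderiv ℝ (rayExtension R) x w) = 0 := by
  have hx0 : x ≠ 0 := fun h => by simp [h] at hx
  have hD : DifferentiableAt ℝ (fderiv ℝ (rayExtension R)) x :=
    ((contDiffAt_rayExtension hR.smooth hx0).fderiv_right (m := ∞) (by simp)).differentiableAt
      (by simp)
  have hline : HasDerivAt (fun t : ℝ => x + t • u) u 0 := by
    simpa using ((hasDerivAt_id (0 : ℝ)).smul_const u).const_add x
  have hD' : HasDerivAt (fun t : ℝ => fderiv ℝ (rayExtension R) (x + t • u))
      (fderiv ℝ (fderiv ℝ (rayExtension R)) x u) 0 :=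
    HasFDerivAt.comp_hasDerivAt_of_eq (f := fun t : ℝ => x + t • u) 0 hD.hasFDerivAt hline
      (by simp)
  have h1 := ((hD'.clm_apply (hasDerivAt_const 0 v)).inner ℝ
    (hD'.clm_apply (hasDerivAt_const 0 w)))
  have hsq : ∀ t : ℝ, ‖x + t • u‖ ^ 2 = 1 + t ^ 2 * ‖u‖ ^ 2 := fun t => by
    rw [norm_add_sq_real, hx, inner_smul_right, hu, norm_smul, mul_pow, Real.norm_eq_abs, sq_abs]
    ring
  have hpos : ∀ t : ℝ, (1 + t ^ 2 * ‖u‖ ^ 2) ≠ 0 := fun t => by positivity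
  have h2 : (fun t : ℝ => inner ℝ (fderiv ℝ (rayExtension R) (x + t • u) v)
      (fderiv ℝ (rayExtension R) (x + t • u) w)) = fun t : ℝ =>
        c * (inner ℝ v w / (1 + t ^ 2 * ‖u‖ ^ 2) -
          t ^ 2 * (inner ℝ u v * inner ℝ u w) / (1 + t ^ 2 * ‖u‖ ^ 2) ^ 2) := by
    funext t
    have hne : x + t • u ≠ 0 := fun h => hpos t (by rw [← hsq, h]; simp)
    rw [hR.inner_fderiv hne, hc _ hne, show ‖x + t • u‖ ^ 4 = (‖x + t • u‖ ^ 2) ^ 2 by ring, hsq,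
      inner_add_left, inner_add_left, hv, hw, inner_smul_left, inner_smul_left]
    simp
    left
    ring
  rw [h2] at h1
  have ht2 : HasDerivAt (fun t : ℝ => t ^ 2) 0 0 := by simpa using hasDerivAt_pow 2 (0 : ℝ)
  have hden : HasDerivAt (fun t : ℝ => 1 + t ^ 2 * ‖u‖ ^ 2) 0 0 := by
    simpa using (ht2.mul_const (‖u‖ ^ 2)).const_add 1
  have h3 := ((((hasDerivAt_const (0 : ℝ) (inner ℝ v w : ℝ)).div hden (hpos 0)).sub
    ((ht2.mul_const (inner ℝ u v * inner ℝ u w : ℝ)).div (hden.pow 2)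
      (pow_ne_zero 2 (hpos 0)))).const_mul c)
  have h4 := h1.unique h3
  simpa using h4

/-- As for the Levi-Civita connection, metric compatibility and symmetry of the second derivative
kill the part of `D²R(u, u)` tangent to the target. Differentiating `⟨R, dR u⟩ = 0` gives the normal
part `-c`. -/
theorem second_fderiv_self {x : E3} (hx : ‖x‖ = 1) (hc0 : 0 < c) {u : E3} (hu1 : ‖u‖ = 1)
    (hu : inner ℝ x u = 0) :
    fderiv ℝ (fderiv ℝ (rayExtension R)) x u u = -c • rayExtension R x := by
  have hx0 : x ≠ 0 := fun h => by simp [h] at hx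
  set L := fderiv ℝ (rayExtension R) x with hL
  set T := fderiv ℝ (fderiv ℝ (rayExtension R)) x with hT
  have hsymm : ∀ v w, T v w = T w v := fun v w =>
    ((contDiffAt_rayExtension hR.smooth hx0).isSymmSndFDerivAt
      (by simp; exact WithTop.coe_le_coe.2 le_top)) v w
  have htan : ∀ w, inner ℝ x w = 0 → inner ℝ (L w) (T u u) = (0 : ℝ) := by
    intro w hw
    have h1 := inner_second_fderiv_add hR hc hx hw hu hu
    have h2 := inner_second_fderiv_add hR hc hx hu hu hw
    rw [← hL, ← hT] at h1 h2
    rw [real_inner_comm (L u) (T w u)] at h1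
    have h3 : inner ℝ (L u) (T u w) = (0 : ℝ) := by
      rw [hsymm]
      linarith
    rw [h3, zero_add, real_inner_comm] at h2
    exact h2
  have hnor : inner ℝ (rayExtension R x) (T u u) = -c := by
    have hD : DifferentiableAt ℝ (fderiv ℝ (rayExtension R)) x :=
      ((contDiffAt_rayExtension hR.smooth hx0).fderiv_right (m := ∞) (by simp)).differentiableAt
        (by simp)
    have h1 := ((differentiableAt_rayExtension hR.smooth hx0).hasFDerivAt.inner ℝ
      (hD.hasFDerivAt.clm_apply (hasFDerivAt_const u x)))
    have h2 : (fun y => inner ℝ (rayExtension R y) (fderiv ℝ (rayExtension R) y u)) =ᶠ[𝓝 x]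
        fun _ => (0 : ℝ) := by
      filter_upwards [isOpen_compl_singleton.mem_nhds hx0] with y hy
      exact inner_rayExtension_fderiv hR.smooth hy u
    have h3 := DFunLike.congr_fun ((h1.congr_of_eventuallyEq h2.symm).unique
      (hasFDerivAt_const _ _)) u
    have h4 := norm_fderiv_sq_of_const hR hc hx hu1 hu
    simp [← hL, ← hT] at h3
    rw [← hL] at h4
    linarith
  have hLu : ‖L u‖ ^ 2 = c := norm_fderiv_sq_of_const hR hc hx hu1 hu
  have hLu0 : ‖L u‖ ≠ 0 := fun h => by rw [h] at hLu; simp at hLu; exact hc0.ne hLu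
  -- Since `c > 0`, `R(x)`, `L u` and `L (x × u)` span the space, so the components found above
  -- determine the vector.
  obtain ⟨b, hb0, hb1, hb2⟩ := exists_orthonormalBasis_cross (norm_rayExtension R x)
    (e := ‖L u‖⁻¹ • L u) (by rw [norm_smul, norm_inv, norm_norm, inv_mul_cancel₀ hLu0])
    (by rw [inner_smul_right, inner_rayExtension_fderiv hR.smooth hx0, mul_zero])
  have hLx : L (cross x u) = cross (rayExtension R x) (L u) :=
    hR.cauchyRiemann ⟨x, mem_sphere_zero_iff_norm.2 hx⟩ u |>.trans (by
      rw [← rayExtension_coe])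
  rw [← b.sum_repr' (T u u), Fin.sum_univ_three, hb0, hb1, hb2, cross_smul_right, ← hLx,
    inner_smul_left, inner_smul_left, htan u hu, htan _ (inner_cross_left x u), hnor]
  simp

/-- Along `γ(t) = cos t p + sin t v` the second derivative of `R ∘ γ` is `D²R(γ', γ') + dR(γ'')`.
The last term vanishes because `γ'' = -γ` is radial, leaving `y'' = -c y`. -/
theorem rayExtension_great_circle (hc0 : 0 < c) {p v : E3} (hp : ‖p‖ = 1) (hv : ‖v‖ = 1)
    (hpv : inner ℝ p v = 0) (t : ℝ) :
    rayExtension R (Real.cos t • p + Real.sin t • v) =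
      Real.cos (√c * t) • rayExtension R p +
        (Real.sin (√c * t) / √c) • fderiv ℝ (rayExtension R) p v := by
  set γ : ℝ → E3 := fun t => Real.cos t • p + Real.sin t • v with hγ
  set δ : ℝ → E3 := fun t => -Real.sin t • p + Real.cos t • v with hδ
  have hpp : inner ℝ p p = (1 : ℝ) := by rw [real_inner_self_eq_norm_sq, hp, one_pow]
  have hvv : inner ℝ v v = (1 : ℝ) := by rw [real_inner_self_eq_norm_sq, hv, one_pow]
  have hvp : inner ℝ v p = (0 : ℝ) := by rw [real_inner_comm, hpv]
  have hγ1 : ∀ t, ‖γ t‖ = 1 := fun t => by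
    rw [← pow_eq_one_iff_of_nonneg (norm_nonneg _) two_ne_zero, ← real_inner_self_eq_norm_sq]
    simp only [hγ, inner_add_left, inner_add_right, inner_smul_left, inner_smul_right, hpp, hvv,
      hpv, hvp, conj_trivial]
    linear_combination Real.sin_sq_add_cos_sq t
  have hδ1 : ∀ t, ‖δ t‖ = 1 := fun t => by
    rw [← pow_eq_one_iff_of_nonneg (norm_nonneg _) two_ne_zero, ← real_inner_self_eq_norm_sq]
    simp only [hδ, inner_add_left, inner_add_right, inner_smul_left, inner_smul_right, hpp, hvv,
      hpv, hvp, conj_trivial]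
    linear_combination Real.sin_sq_add_cos_sq t
  have hγδ : ∀ t, inner ℝ (γ t) (δ t) = (0 : ℝ) := fun t => by
    simp only [hγ, hδ, inner_add_left, inner_add_right, inner_smul_left, inner_smul_right, hpp, hvv,
      hpv, hvp, conj_trivial]
    ring
  have hγ0 : ∀ t, γ t ≠ 0 := fun t h => by simpa [h] using hγ1 t
  have hγd : ∀ t, HasDerivAt γ (δ t) t := fun t =>
    ((Real.hasDerivAt_cos t).smul_const p).add ((Real.hasDerivAt_sin t).smul_const v)
  have hδd : ∀ t, HasDerivAt δ (-γ t) t := fun t => by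
    refine (((Real.hasDerivAt_sin t).neg.smul_const p).add
      ((Real.hasDerivAt_cos t).smul_const v)).congr_deriv ?_
    simp only [hγ]
    module
  have hy : ∀ t, HasDerivAt (fun t => rayExtension R (γ t))
      (fderiv ℝ (rayExtension R) (γ t) (δ t)) t := fun t =>
    (differentiableAt_rayExtension hR.smooth (hγ0 t)).hasFDerivAt.comp_hasDerivAt t (hγd t)
  have hz : ∀ t, HasDerivAt (fun t => fderiv ℝ (rayExtension R) (γ t) (δ t))
      (-(√c ^ 2) • rayExtension R (γ t)) t := fun t => by
    have hD : DifferentiableAt ℝ (fderiv ℝ (rayExtension R)) (γ t) :=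
      ((contDiffAt_rayExtension hR.smooth (hγ0 t)).fderiv_right (m := ∞)
        (by simp)).differentiableAt (by simp)
    refine ((hD.hasFDerivAt.comp_hasDerivAt t (hγd t)).clm_apply (hδd t)).congr_deriv ?_
    rw [second_fderiv_self hR hc (hγ1 t) hc0 (hδ1 t) (hγδ t), map_neg, Function.comp_apply,
      fderiv_rayExtension_self hR.smooth (hγ0 t), neg_zero, add_zero, Real.sq_sqrt hc0.le]
  have h := eq_cos_smul_add_sin_smul_of_hasDerivAt (Real.sqrt_pos.2 hc0).ne' hy hz t
  simpa [hγ, hδ] using h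

theorem conformalFactor_eq_one_of_const (hc0 : 0 < c) : c = 1 := by
  set p : E3 := basisVec 0 with hpdef
  have hp : ‖p‖ = 1 := by simp [hpdef, basisVec]
  obtain ⟨e, he, hpe⟩ := exists_unit_orthogonal p
  have hq : 0 < √c := Real.sqrt_pos.2 hc0
  -- The great circles from `p` in the directions `e` and `-e` meet at `-p`, and the two formulas
  -- for `R(-p)` differ in the sign of the sine term.
  have hsin : Real.sin (√c * Real.pi) = 0 := by
    have h1 := rayExtension_great_circle hR hc hc0 hp he hpe Real.pi
    have h2 := rayExtension_great_circle hR hc hc0 hp (v := -e) (by rwa [norm_neg])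
      (by rw [inner_neg_right, hpe, neg_zero]) Real.pi
    simp only [Real.sin_pi, zero_smul] at h1 h2
    rw [h1, map_neg, smul_neg, add_right_inj, eq_neg_iff_add_eq_zero, ← two_smul ℝ, smul_smul,
      smul_eq_zero] at h2
    have h3 : fderiv ℝ (rayExtension R) p e ≠ 0 := fun h => by
      have := norm_fderiv_sq_of_const hR hc hp he hpe
      rw [h] at this
      simp at this
      exact hc0.ne this
    have h4 := h2.resolve_right h3
    simpa [hq.ne'] using h4
  have hq1 : √c = 1 := by
    rcases lt_trichotomy (√c) 1 with h | h | h
    · have : 0 < Real.sin (√c * Real.pi) := Real.sin_pos_of_pos_of_lt_pi (by positivity)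
        (by nlinarith [Real.pi_pos])
      exact absurd hsin this.ne'
    · exact h
    · exfalso
      -- At distance `π / √c < π` from `p` the whole circle of latitude is sent to `-R(p)`. So `dR`
      -- vanishes along it, although `dR` multiplies tangent lengths by `√c > 0`.
      set t := Real.pi / √c with ht
      have htpos : 0 < Real.sin t := Real.sin_pos_of_pos_of_lt_pi (by positivity)
        (div_lt_self Real.pi_pos h)
      set e' := cross p e with he'
      have hpp : inner ℝ p p = (1 : ℝ) := by rw [real_inner_self_eq_norm_sq, hp, one_pow]
      have hee : inner ℝ e e = (1 : ℝ) := by rw [real_inner_self_eq_norm_sq, he, one_pow]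
      have hpe' : inner ℝ p e' = (0 : ℝ) := inner_cross_left p e
      have hee' : inner ℝ e e' = (0 : ℝ) := inner_cross_right p e
      have he'e : inner ℝ e' e = (0 : ℝ) := by rw [real_inner_comm, hee']
      have he'e' : inner ℝ e' e' = (1 : ℝ) := by
        rw [he', inner_cross_cross, hpp, hee, hpe]; norm_num
      have hconst : ∀ s : ℝ, rayExtension R (Real.cos t • p + Real.sin t •
          (Real.cos s • e + Real.sin s • e')) = -rayExtension R p := by
        intro s
        have hunit : ‖Real.cos s • e + Real.sin s • e'‖ = 1 := by
          rw [← pow_eq_one_iff_of_nonneg (norm_nonneg _) two_ne_zero, ← real_inner_self_eq_norm_sq]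
          simp only [inner_add_left, inner_add_right, inner_smul_left, inner_smul_right, hee,
            hee', he'e, he'e', conj_trivial]
          linear_combination Real.sin_sq_add_cos_sq s
        rw [rayExtension_great_circle hR hc hc0 hp hunit (by
          rw [inner_add_right, inner_smul_right, inner_smul_right, hpe, hpe']; ring)]
        have : √c * t = Real.pi := by rw [ht]; field_simp
        rw [this, Real.cos_pi, Real.sin_pi]
        simp
      set x := Real.cos t • p + Real.sin t • e with hx
      have hx1 : ‖x‖ = 1 := by
        have hep : inner ℝ e p = (0 : ℝ) := by rw [real_inner_comm, hpe]
        rw [← pow_eq_one_iff_of_nonneg (norm_nonneg _) two_ne_zero, ← real_inner_self_eq_norm_sq]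
        simp only [hx, inner_add_left, inner_add_right, inner_smul_left, inner_smul_right, hee,
          hpp, hpe, hep, conj_trivial]
        linear_combination Real.sin_sq_add_cos_sq t
      have hx0 : x ≠ 0 := fun h => by simp [h] at hx1
      have hxe' : inner ℝ x e' = (0 : ℝ) := by
        rw [hx, inner_add_left, inner_smul_left, inner_smul_left, hpe', hee']; simp
      have hd : HasDerivAt (fun s : ℝ => Real.cos t • p + Real.sin t •
          (Real.cos s • e + Real.sin s • e')) (Real.sin t • e') 0 := by
        have h1 := (((((Real.hasDerivAt_cos 0).smul_const e).add
          ((Real.hasDerivAt_sin 0).smul_const e')).const_smul (Real.sin t)).const_add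
            (Real.cos t • p))
        simpa using h1
      have hd2 := HasFDerivAt.comp_hasDerivAt_of_eq (0 : ℝ)
        (differentiableAt_rayExtension hR.smooth hx0).hasFDerivAt hd (by simp [hx])
      have hd3 := hd2.congr_of_eventuallyEq (Eventually.of_forall fun s => (hconst s).symm)
      have hd4 := hd3.unique (hasDerivAt_const _ _)
      have hn := norm_fderiv_sq_of_const hR hc hx1 (v := e')
        (by rw [← pow_eq_one_iff_of_nonneg (norm_nonneg _) two_ne_zero,
          ← real_inner_self_eq_norm_sq, he'e']) hxe'
      rw [map_smul, smul_eq_zero] at hd4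
      rw [hd4.resolve_left htpos.ne'] at hn
      simp at hn
      exact hc0.ne hn
  rw [← Real.sq_sqrt hc0.le, hq1, one_pow]

end

/-- The triple product is the volume form, so `L` scales it by its determinant. -/
theorem inner_cross_map (L : E3 →L[ℝ] E3) (u v w : E3) :
    inner ℝ (L u) (cross (L v) (L w)) = L.det * inner ℝ u (cross v w) := by
  have hL : ∀ u i, L u i = u 0 * L (basisVec 0) i + u 1 * L (basisVec 1) i
      + u 2 * L (basisVec 2) i := fun u i => by
    conv_lhs => rw [← sum_basisVec u]
    simp [Fin.sum_univ_three]
  rw [det_eq_matrix_det, Matrix.det_fin_three]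
  simp only [inner_eq_sum, cross_zero_apply, cross_one_apply, cross_two_apply, hL u, hL v, hL w,
    Matrix.of_apply]
  ring

theorem eq_of_conformalFactor_eq_zero {R : S2 → S2} (hR : IsHolomorphic R)
    (hc : ∀ x : E3, x ≠ 0 → conformalFactor R x = 0) (m n : S2) : R m = R n := by
  have hconn : IsPreconnected ({0}ᶜ : Set E3) := (isConnected_compl_singleton_of_one_lt_rank
    (Module.lt_rank_of_lt_finrank (by simp)) 0).isPreconnected
  have h : rayExtension R (m : E3) = rayExtension R (n : E3) := by
    refine isOpen_compl_singleton.is_const_of_fderiv_eq_zero (𝕜 := ℝ) hconn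
      (fun z hz => (differentiableAt_rayExtension hR.smooth hz).differentiableWithinAt)
      (fun z hz => ?_) (ne_zero_of_mem_sphere m) (ne_zero_of_mem_sphere n)
    ext1 v
    have h1 := hR.inner_fderiv hz v v
    rw [hc z hz, zero_mul, inner_self_eq_zero] at h1
    exact h1
  rw [rayExtension_coe, rayExtension_coe] at h
  exact Subtype.ext h

/-- The candidate sends `p` to `R(p)` and acts as `dR_p` on the orthogonal plane, an isometry since
the conformal factor is 1. With `c = 1` the great circle formula says that `R` agrees with it along
every great circle through `p`. -/
theorem exists_rotation_of_conformalFactor_eq_one {R : S2 → S2} (hR : IsHolomorphic R)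
    (hc : ∀ x : E3, x ≠ 0 → conformalFactor R x = 1) (p : S2) :
    ∃ A : E3 ≃ₗᵢ[ℝ] E3, LinearMap.det (A.toLinearEquiv : E3 →ₗ[ℝ] E3) = 1 ∧
      ∀ n : S2, (R n : E3) = A (n : E3) := by
  have hp : ‖(p : E3)‖ = 1 := norm_coe_S2 p
  have hp0 := ne_zero_of_mem_sphere p
  set L : E3 →L[ℝ] E3 := (innerSL ℝ (p : E3)).smulRight (R p : E3) +
    fderiv ℝ (rayExtension R) p with hLdef
  have hL : ∀ x, L x = (inner ℝ (p : E3) x : ℝ) • (R p : E3) +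
      fderiv ℝ (rayExtension R) p x := fun x => by simp [hLdef]
  have hRp : rayExtension R p = R p := rayExtension_coe R p
  have hLn : ∀ x, ‖L x‖ = ‖x‖ := fun x => by
    have h1 : inner ℝ (R p : E3) (fderiv ℝ (rayExtension R) p x) = (0 : ℝ) := by
      rw [← hRp]; exact inner_rayExtension_fderiv hR.smooth hp0 x
    have h2 := inner_fderiv_of_const hR hc hp x x
    rw [real_inner_self_eq_norm_sq, real_inner_self_eq_norm_sq, one_mul] at h2
    rw [← sq_eq_sq₀ (norm_nonneg _) (norm_nonneg _), hL, norm_add_sq_real, inner_smul_left, h1,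
      h2, norm_smul, norm_coe_S2, Real.norm_eq_abs, mul_one, sq_abs]
    ring
  have hdet : L.det = 1 := by
    obtain ⟨e, he, hpe⟩ := exists_unit_orthogonal (p : E3)
    -- The Cauchy–Riemann equation sends the positive frame `p, e, p × e` to a positive one, which
    -- fixes the sign of the determinant.
    have h1 := inner_cross_map L (cross p e) p e
    have hpp : inner ℝ (p : E3) (p : E3) = (1 : ℝ) := by
      rw [real_inner_self_eq_norm_sq, hp, one_pow]
    have hee : inner ℝ e e = (1 : ℝ) := by rw [real_inner_self_eq_norm_sq, he, one_pow]
    have hLp : L p = R p := by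
      rw [hL, hpp, one_smul, fderiv_rayExtension_self hR.smooth hp0, add_zero]
    have hLe : L e = fderiv ℝ (rayExtension R) p e := by rw [hL, hpe, zero_smul, zero_add]
    have hLpe : L (cross p e) = cross (R p) (L e) := by
      rw [hL, inner_cross_left, zero_smul, zero_add, hR.cauchyRiemann, hLe]
    have hRe : inner ℝ (R p : E3) (L e) = (0 : ℝ) := by
      rw [hLe, ← hRp]; exact inner_rayExtension_fderiv hR.smooth hp0 e
    rw [hLpe, hLp, inner_cross_cross, inner_cross_cross, hRe, hpe, hpp, hee,
      real_inner_self_eq_norm_sq, real_inner_self_eq_norm_sq, norm_coe_S2, hLn, he] at h1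
    linarith
  set A : E3 ≃ₗᵢ[ℝ] E3 :=
    (⟨(L : E3 →ₗ[ℝ] E3), hLn⟩ : E3 →ₗᵢ[ℝ] E3).toLinearIsometryEquiv rfl with hA
  have hAL : ∀ x, A x = L x := fun x => rfl
  refine ⟨A, ?_, fun n => ?_⟩
  · rw [← hdet, ContinuousLinearMap.det]
    congr 1
  · obtain ⟨t, v, hv, hpv, hn⟩ := exists_eq_cos_smul_add_sin_smul hp (norm_coe_S2 n)
    have h1 := rayExtension_great_circle hR hc one_pos hp hv hpv t
    have hpp : inner ℝ (p : E3) (p : E3) = (1 : ℝ) := by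
      rw [real_inner_self_eq_norm_sq, hp, one_pow]
    rw [← hn, rayExtension_coe, hRp, Real.sqrt_one, one_mul, div_one] at h1
    rw [h1, hAL, hn, map_add, map_smul, map_smul, hL, hL, hpp, hpv, one_smul,
      fderiv_rayExtension_self hR.smooth hp0, add_zero, zero_smul, zero_add]

theorem exists_rotation_of_conformalFactor_const {R : S2 → S2} (hR : IsHolomorphic R) {c : ℝ}
    (hc : ∀ x : E3, x ≠ 0 → conformalFactor R x = c) (hne : ∃ m n : S2, R m ≠ R n) :
    ∃ A : E3 ≃ₗᵢ[ℝ] E3, LinearMap.det (A.toLinearEquiv : E3 →ₗ[ℝ] E3) = 1 ∧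
      ∀ n : S2, (R n : E3) = A (n : E3) := by
  obtain ⟨m, n, hmn⟩ := hne
  have hcnn : 0 ≤ c := by
    rw [← hc m (ne_zero_of_mem_sphere m), conformalFactor]
    positivity
  rcases hcnn.eq_or_lt with rfl | hc0
  · exact absurd (eq_of_conformalFactor_eq_zero hR hc m n) hmn
  · obtain rfl : c = 1 := conformalFactor_eq_one_of_const hR hc hc0
    exact exists_rotation_of_conformalFactor_eq_one hR hc m

/-! ### Degenerate profiles and the rigidity theorem -/

/-- The limit at infinity makes the constant `sin² f` zero. Then `f' cos f = 0` with `cos f = ±1`,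
so `f` is constant and again equal to its limit. -/
theorem IsProfile.eq_zero_of_deriv_sin_sq {k : ℤ} {f : ℝ → ℝ} (hf : IsProfile k f)
    (h : ∀ r, 0 < r → deriv (fun r => Real.sin (f r) ^ 2) r = 0) {r : ℝ} (hr : 0 ≤ r) :
    f r = 0 := by
  have hconst : ∀ {g : ℝ → ℝ}, DifferentiableOn ℝ g (Ioi 0) → (∀ r, 0 < r → deriv g r = 0) →
      Tendsto g atTop (𝓝 0) → ∀ r, 0 < r → g r = 0 := by
    intro g hg hg' hlim r hr
    have h1 : ∀ s, 0 < s → g s = g r := fun s hs =>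
      isOpen_Ioi.is_const_of_deriv_eq_zero isPreconnected_Ioi hg (fun x hx => hg' x hx) hs hr
    exact tendsto_nhds_unique (tendsto_const_nhds.congr' (by
      filter_upwards [eventually_gt_atTop 0] with s hs using (h1 s hs).symm)) hlim
  have hd : ∀ r, 0 < r → HasDerivAt f (deriv f r) r := fun r hr =>
    (hf.differentiableAt hr).hasDerivAt
  have hsin : ∀ r, 0 < r → Real.sin (f r) = 0 := fun r hr => by
    have h1 := hconst (g := fun r => Real.sin (f r) ^ 2)
      (fun s hs => ((hd s hs).sin.pow 2).differentiableAt.differentiableWithinAt) h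
      (by simpa [Function.comp_def] using
        (((Real.continuous_sin.tendsto 0).comp hf.infty).pow 2)) r hr
    exact pow_eq_zero_iff two_ne_zero |>.1 h1
  have hderiv : ∀ r, 0 < r → deriv f r = 0 := fun r hr => by
    have h1 := (hd r hr).sin
    have h2 : (fun s => Real.sin (f s)) =ᶠ[𝓝 r] fun _ => 0 := by
      filter_upwards [Ioi_mem_nhds hr] with s hs using hsin s hs
    have h3 := (h1.congr_of_eventuallyEq h2.symm).unique (hasDerivAt_const _ _)
    have h4 : Real.cos (f r) ≠ 0 := fun h0 => by
      have := Real.sin_sq_add_cos_sq (f r)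
      rw [hsin r hr, h0] at this
      norm_num at this
    exact (mul_eq_zero.1 h3).resolve_left h4
  have hpos : ∀ r, 0 < r → f r = 0 :=
    hconst (fun s hs => (hd s hs).differentiableAt.differentiableWithinAt) hderiv hf.infty
  rcases hr.eq_or_lt with rfl | hr
  · have h1 : Tendsto f (𝓝[>] 0) (𝓝 (f 0)) :=
      (hf.smooth.continuousOn 0 self_mem_Ici).mono Ioi_subset_Ici_self
    refine tendsto_nhds_unique h1 (tendsto_const_nhds.congr' ?_)
    filter_upwards [self_mem_nhdsWithin] with s hs using (hpos s hs).symm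
  · exact hpos r hr

theorem suspension_eq_hedgehog_of_rotation {k : ℤ} {f : ℝ → ℝ} (hf : IsProfile k f)
    {R : S2 → S2} {A : E3 ≃ₗᵢ[ℝ] E3} (hA : ∀ n : S2, (R n : E3) = A (n : E3)) (x : E3) :
    suspension f R x = hedgehog f (A x) := by
  apply Subtype.ext
  rw [hedgehog, coe_suspension, coe_suspension, A.norm_map]
  by_cases hx : x = 0
  -- At the origin the arbitrary direction is harmless because `sin (f 0) = sin (kπ) = 0`.
  · simp [hx, hf.sin_zero]
  · have hAx : A x ≠ 0 := fun h => hx (by simpa using h)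
    rw [rayExtension_id hAx, rayExtension, hA, coe_direction hx, A.norm_map, map_smul]

theorem exists_rotation_of_restrictedHarmonic_suspension {k : ℤ} {f : ℝ → ℝ} {R : S2 → S2}
    (hf : IsProfile k f) (hR : IsHolomorphic R) (hne : ∃ m n : S2, R m ≠ R n)
    (H : RestrictedHarmonic {0}ᶜ (suspension f R)) :
    ∃ A : E3 ≃ₗᵢ[ℝ] E3, LinearMap.det (A.toLinearEquiv : E3 →ₗ[ℝ] E3) = 1 ∧
      (∀ x : E3, suspension f R x = hedgehog f (A x)) ∧
      ((∃ r : ℝ, 0 ≤ r ∧ f r ≠ 0) → ∀ n : S2, (R n : E3) = A (n : E3)) := by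
  by_cases hs : ∃ r, 0 < r ∧ deriv (fun r => Real.sin (f r) ^ 2) r ≠ 0
  · obtain ⟨r, hr, hs⟩ := hs
    obtain ⟨A, hdet, hA⟩ := exists_rotation_of_conformalFactor_const hR
      -- The default value of `direction` at `0` serves as an arbitrary reference point of the
      -- sphere.
      (c := conformalFactor R (direction 0))
      (fun x hx => conformalFactor_const_of_restrictedHarmonic hf hR H hr hs hx
        (ne_zero_of_mem_sphere _)) hne
    exact ⟨A, hdet, suspension_eq_hedgehog_of_rotation hf hA, fun _ => hA⟩
  -- Here `f = 0` on `[0, ∞)`, so both fields are the constant vacuum whatever `R` is; the identity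
  -- rotation works and the last clause is vacuous.
  · push Not at hs
    have hf0 : ∀ r, 0 ≤ r → f r = 0 := fun r hr => hf.eq_zero_of_deriv_sin_sq hs hr
    refine ⟨LinearIsometryEquiv.refl ℝ E3, LinearMap.det_id, fun x => ?_, ?_⟩
    · apply Subtype.ext
      rw [hedgehog, coe_suspension, coe_suspension, LinearIsometryEquiv.norm_map,
        hf0 _ (norm_nonneg x)]
      simp
    · rintro ⟨r, hr, h⟩
      exact absurd (hf0 r hr) h

end Skyrme

/-! ### The three statements together -/

theorem mainTheorem10 :
    -- every hedgehog of finite Dirichlet energy is a restricted harmonic Skyrme field of degree `k`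
    (∀ (k : ℤ) (f : ℝ → ℝ), Skyrme.IsProfile k f →
      Skyrme.FiniteEnergy {0}ᶜ (Skyrme.hedgehog f) →
        Skyrme.IsSkyrmeField (Skyrme.hedgehog f) ∧
        Skyrme.HasDegree (Skyrme.hedgehog f) k ∧
        Skyrme.RestrictedHarmonic {0}ᶜ (Skyrme.hedgehog f) ∧
        (Skyrme.SmoothOn Set.univ (Skyrme.hedgehog f) →
          Skyrme.RestrictedHarmonic Set.univ (Skyrme.hedgehog f))) ∧
    -- there are such examples, smooth on all of `ℝ³`, in every degree class
    (∀ k : ℤ, ∃ f : ℝ → ℝ, Skyrme.IsProfile k f ∧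
      (0 ≤ k → AntitoneOn f (Set.Ici 0)) ∧ (k ≤ 0 → MonotoneOn f (Set.Ici 0)) ∧
      Skyrme.IsSkyrmeField (Skyrme.hedgehog f) ∧
      Skyrme.HasDegree (Skyrme.hedgehog f) k ∧
      Skyrme.RestrictedHarmonic Set.univ (Skyrme.hedgehog f)) ∧
    -- within the rational map ansatz, only hedgehogs (up to a rotation) are restricted harmonic
    (∀ (k : ℤ) (f : ℝ → ℝ) (R : Skyrme.S2 → Skyrme.S2), Skyrme.IsProfile k f →
      Skyrme.IsHolomorphic R → (∃ m n : Skyrme.S2, R m ≠ R n) →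
      Skyrme.RestrictedHarmonic {0}ᶜ (Skyrme.suspension f R) →
        ∃ A : Skyrme.E3 ≃ₗᵢ[ℝ] Skyrme.E3, LinearMap.det (A.toLinearEquiv : Skyrme.E3 →ₗ[ℝ] Skyrme.E3) = 1 ∧
          (∀ x : Skyrme.E3, Skyrme.suspension f R x = Skyrme.hedgehog f (A x)) ∧
          ((∃ r : ℝ, 0 ≤ r ∧ f r ≠ 0) →
            ∀ n : Skyrme.S2, (R n : Skyrme.E3) = A (n : Skyrme.E3))) := by
  refine ⟨fun k f hf hfin => ⟨hf.isSkyrmeField Skyrme.contDiffOn_rayExtension_id,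
    hf.hasDegree_hedgehog hfin, hf.restrictedHarmonic_hedgehog_compl_zero hfin,
    hf.restrictedHarmonic_hedgehog hfin⟩, fun k => ?_, fun k f R hf hR hne H =>
    Skyrme.exists_rotation_of_restrictedHarmonic_suspension hf hR hne H⟩
  have hf := Skyrme.isProfile_transitionProfile k
  have hfin := Skyrme.finiteEnergy_hedgehog_transitionProfile k
  exact ⟨Skyrme.transitionProfile k, hf,
    fun hk => (Skyrme.antitone_transitionProfile hk).antitoneOn _,
    fun hk => (Skyrme.monotone_transitionProfile hk).monotoneOn _,
    hf.isSkyrmeField Skyrme.contDiffOn_rayExtension_id, hf.hasDegree_hedgehog hfin,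
    hf.restrictedHarmonic_hedgehog hfin (Skyrme.smoothOn_hedgehog_transitionProfile k)⟩
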